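/- Let $p$ be a prime, $p\ne 2$, let $n\ge 1$ be an integer not divisible by $p$, and let $q=p^n$. Let $K$ be the unramified extension of $\mathbb Q_p$ of degree $n$, with norm map $N:K\to\mathbb Q_p$, and identify $\mathbb Q_p^n$ with $K$ by means of a basis of $K$ over $\mathbb Q_p$. Let $\mathbb Q_p^{(1)}=\{p^\nu u:\nu\in\mathbb Z,\ u\in 1+p\mathbb Z_p\}$, let $\mu_{q-1}\subset K^*$ be the group of roots of unity of degree $q-1$, for $x=p^\nu\omega u\in K^*$ ($\nu\in\mathbb Z$, $\omega\in\mu_{q-1}$, $u$ a principal unit of $K$) write $\omega(x)=\omega$, and let $\Sigma_n=\{y\in K^*:\omega(y)=1,\ N(y)=1\}$ and $Z_n=\mu_{q-1}\times\Sigma_n$. Let $\mathcal D(\mathbb Q_p^n)$, $\mathcal D(K)$ be the spaces of complex-valued locally constant functions with compact support, $\mathcal D(Z_n)$ the space of complex-valued locally constant functions on the compact space $Z_n$, and $\mathcal D'$ the spaces of linear functionals on them. Let $\pi(z)=|z|_p^s\,\theta(z)$ be a quasicharacter of $\mathbb Q_p^*$, where $s\in\mathbb C$ and $\theta:\mathbb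 Q_p^*\to\mathbb C^*$ is a continuous homomorphism with $|\theta|=1$ and $\theta(p)=1$. Assume that $\pi$ is non-exceptional, that is, $\pi(r)$ is not identically equal to $|r|_p^{-n}$ on $\mathbb Q_p^{(1)}$. Let $f\in\mathcal D'(\mathbb Q_p^n)$ be homogeneous of degree $\pi$, that is, $$\langle f,\varphi_\lambda\rangle=\pi(\lambda)|\lambda|_p^n\langle f,\varphi\rangle,\qquad \varphi_\lambda(x)=\varphi(\lambda^{-1}x),$$ for all $\varphi\in\mathcal D(\mathbb Q_p^n)$ and $\lambda\in\mathbb Q_p^{(1)}$. Then there is $F\in\mathcal D'(Z_n)$ such that, as a distribution on $K$, $f=\pi(r)F$. This means that for every $\varphi\in\mathcal D(K)$ the integral $$p^{1-n}(p^n-1)\int_{\mathbb Q_p^{(1)}}\langle F,\varphi(r\,\cdot)\rangle\,|r|_p^{z+n-1}\theta(r)\,dr,$$ where $\varphi(r\,\cdot)$ is the function $(\omega,\xi)\mapsto\varphi(r\omega\xi)$ on $Z_n$ and $dr$ is the Haar measure of $\mathbb Q_p$ with $\int_{\mathbb Z_p}dr=1$, converges absolutely for $\operatorname{Re}z>-n$,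 has an analytic continuation in $z$ to the set of all $z\in\mathbb C$ for which $|\cdot|_p^z\theta$ is non-exceptional, and the value of this continuation at $z=s$ is $\langle f,\varphi\rangle$. -/

import Mathlib

open MeasureTheory

noncomputable section

/-! ### Bruhat-Schwartz test functions and distributions -/

/-- Locally constant functions `X → ℂ` with compact support. -/
def BSTestFunction (X : Type*) [TopologicalSpace X] : Submodule ℂ (LocallyConstant X ℂ) where
  carrier := {φ | HasCompactSupport (φ : X → ℂ)}
  add_mem' := fun ha hb => by
    simpa using HasCompactSupport.add ha hb
  zero_mem' := by
    simpa using HasCompactSupport.zero (α := X) (β := ℂ)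
  smul_mem' := fun c φ hφ =>
    HasCompactSupport.mono (f := (φ : X → ℂ)) hφ (Function.support_const_smul_subset c _)

/-- Bruhat-Schwartz distributions: all linear functionals on the test functions. -/
abbrev BSDistribution (X : Type*) [TopologicalSpace X] : Type _ := Module.Dual ℂ (BSTestFunction X)

/-- Composition of a test function with a homeomorphism, `φ ↦ φ ∘ e`. -/
def BSTestFunction.comp {X Y : Type*} [TopologicalSpace X] [TopologicalSpace Y] (e : X ≃ₜ Y) :
    BSTestFunction Y →ₗ[ℂ] BSTestFunction X where
  toFun φ := ⟨φ.1.comap (e : C(X, Y)), by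
    have h : HasCompactSupport ((φ.1 : Y → ℂ) ∘ e) := φ.2.comp_homeomorph e
    exact h⟩
  map_add' _ _ := rfl
  map_smul' _ _ := rfl

/-- Transport of distributions along a homeomorphism: `⟨e f, φ⟩ = ⟨f, φ ∘ e⟩`. -/
def BSDistribution.map {X Y : Type*} [TopologicalSpace X] [TopologicalSpace Y] (e : X ≃ₜ Y)
    (f : BSDistribution X) : BSDistribution Y := f ∘ₗ BSTestFunction.comp e

/-! ### The p-adic numbers -/

instance Padic.instMeasurableSpaceBorel (p : ℕ) [Fact p.Prime] : MeasurableSpace ℚ_[p] :=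
  borel ℚ_[p]

instance Padic.instBorelSpace (p : ℕ) [Fact p.Prime] : BorelSpace ℚ_[p] := ⟨rfl⟩

/-- The unit ball `ℤ_p` of `ℚ_p`, as a compact set with non-empty interior. -/
def padicUnitBall (p : ℕ) [Fact p.Prime] : TopologicalSpace.PositiveCompacts ℚ_[p] where
  carrier := Metric.closedBall 0 1
  isCompact' := isCompact_closedBall 0 1
  interior_nonempty' :=
    ⟨0, Metric.ball_subset_interior_closedBall (Metric.mem_ball_self one_pos)⟩

/-- The additive Haar measure `dr` of `ℚ_p`, normalized by `∫_{ℤ_p} dr = 1`. -/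
def padicHaar (p : ℕ) [Fact p.Prime] : Measure ℚ_[p] :=
  Measure.addHaarMeasure (padicUnitBall p)

/-- `ℚ_p^{(1)}`: the elements `p ^ ν * u` with `ν ∈ ℤ` and `u` a principal unit of `ℚ_p`. -/
def padicPos (p : ℕ) [Fact p.Prime] : Set ℚ_[p] :=
  {ζ | ∃ ν : ℤ, ∃ u : ℚ_[p], ‖u - 1‖ < 1 ∧ ζ = (p : ℚ_[p]) ^ ν * u}

/-- The quasicharacter `π(z) = |z|_p ^ s * θ(z)` of `ℚ_p^*`. -/
def quasichar {p : ℕ} [Fact p.Prime] (s : ℂ) (θ : ℚ_[p] →*₀ ℂ) (z : ℚ_[p]) : ℂ :=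
  (‖z‖ : ℂ) ^ s * θ z

/-- The exceptional case: `π(r) = |r|_p ^ (-n)` for the radial variable `r ∈ ℚ_p^{(1)}`. -/
def IsExceptional {p : ℕ} [Fact p.Prime] (n : ℕ) (s : ℂ) (θ : ℚ_[p] →*₀ ℂ) : Prop :=
  ∀ r ∈ padicPos p, quasichar s θ r = (‖r‖ : ℂ) ^ (-(n : ℂ))

/-- `f ∈ D'(ℚ_p^n)` is homogeneous of degree `π`:
`⟨f, φ_t⟩ = π(t) |t|_p ^ n ⟨f, φ⟩` with `φ_t(x) = φ(t⁻¹ x)`, for all `t ∈ ℚ_p^{(1)}`. -/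
def IsHomogeneousDistribution {p : ℕ} [Fact p.Prime] {n : ℕ} (π : ℚ_[p] → ℂ)
    (f : BSDistribution (Fin n → ℚ_[p])) : Prop :=
  ∀ (φ : BSTestFunction (Fin n → ℚ_[p])) (t : ℚ_[p]) (ht : t ≠ 0), t ∈ padicPos p →
    f (BSTestFunction.comp (Homeomorph.smulOfNeZero t⁻¹ (inv_ne_zero ht)) φ) =
      π t * (‖t‖ : ℂ) ^ n * f φ

/-! ### The unramified extension

`K` is a finite extension of `ℚ_p` with the (unique) absolute value that extends that of `ℚ_p`. -/

open scoped NormedField Valued in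
/-- The number `q` of elements of the residue field `O/P` of `K`. -/
def residueCard (p : ℕ) [Fact p.Prime] (K : Type*) [NormedField K] [NormedAlgebra ℚ_[p] K] : ℕ :=
  haveI : IsUltrametricDist K := IsUltrametricDist.of_normedAlgebra ℚ_[p]
  Nat.card 𝓀[K]

/-- `K` is unramified over `ℚ_p`: the normalized absolute value `|N(x)|_p` of `K` has the value
`1 / q` at `p`. -/
def IsUnramifiedOverPadic (p : ℕ) [Fact p.Prime] (K : Type*) [NormedField K]
    [NormedAlgebra ℚ_[p] K] : Prop :=
  ‖Algebra.norm ℚ_[p] (p : K)‖ = ((residueCard p K : ℕ) : ℝ)⁻¹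

/-- `ω(x) = ω`: `x = p ^ ν * ω * u`, with `ω ∈ μ_{q-1}`, `q = p ^ n`, and `u` a principal unit
of `K`. -/
def HasRootPart (p n : ℕ) {K : Type*} [NormedField K] (x ω : K) : Prop :=
  ω ^ (p ^ n - 1) = 1 ∧ ∃ ν : ℤ, ∃ u : K, ‖u - 1‖ < 1 ∧ x = (p : K) ^ ν * ω * u

/-- The set `μ_{q-1}` of roots of unity, `q = p ^ n`. -/
def muSet (p n : ℕ) (K : Type*) [NormedField K] : Set K := {ω | ω ^ (p ^ n - 1) = 1}

/-- `Σ_n = {y ∈ K^* : ω(y) = 1, N(y) = 1}`. -/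
def sigmaSet (p : ℕ) [Fact p.Prime] (n : ℕ) (K : Type*) [NormedField K]
    [NormedAlgebra ℚ_[p] K] : Set K :=
  {y | y ≠ 0 ∧ HasRootPart p n y 1 ∧ Algebra.norm ℚ_[p] y = 1}

/-- `Z_n = μ_{q-1} × Σ_n`. -/
abbrev SphereZ (p : ℕ) [Fact p.Prime] (n : ℕ) (K : Type*) [NormedField K]
    [NormedAlgebra ℚ_[p] K] : Type _ := muSet p n K × sigmaSet p n K

/-- `D'(Z_n)`: all linear functionals on the locally constant functions on the compact
space `Z_n`. -/
abbrev SphereDistribution (p : ℕ) [Fact p.Prime] (n : ℕ) (K : Type*) [NormedField K]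
    [NormedAlgebra ℚ_[p] K] : Type _ := Module.Dual ℂ (LocallyConstant (SphereZ p n K) ℂ)

/-- The function `φ(r ·)` on `Z_n`: `(ω, ξ) ↦ φ(r ω ξ)`. -/
def sphereRestrict {p : ℕ} [Fact p.Prime] {n : ℕ} {K : Type*} [NormedField K]
    [NormedAlgebra ℚ_[p] K] (φ : BSTestFunction K) (r : ℚ_[p]) :
    LocallyConstant (SphereZ p n K) ℂ :=
  φ.1.comap ⟨fun η => r • ((η.1 : K) * (η.2 : K)), by fun_prop⟩

/-- The integrand `⟨F, φ(r ·)⟩ |r|_p ^ (s+n-1) θ(r)`. -/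
def radialIntegrand {p : ℕ} [Fact p.Prime] {n : ℕ} {K : Type*} [NormedField K]
    [NormedAlgebra ℚ_[p] K] (F : SphereDistribution p n K) (θ : ℚ_[p] →*₀ ℂ)
    (φ : BSTestFunction K) (s : ℂ) (r : ℚ_[p]) : ℂ :=
  F (sphereRestrict φ r) * (‖r‖ : ℂ) ^ (s + n - 1) * θ r

/-- `f = π(r) F` for `π = |·|_p ^ s θ`. For `Re z > -n` the distribution `|r|_p ^ z θ(r) F` is
given by the absolutely convergent integral
`p ^ (1-n) (p ^ n - 1) ∫_{ℚ_p^{(1)}} ⟨F, φ(r ·)⟩ |r|_p ^ (z+n-1) θ(r) dr`;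
`⟨f, φ⟩` is the value at `z = s` of the analytic continuation of this integral in `z` to the domain
of all non-exceptional `z`. -/
def IsRadialProduct {p : ℕ} [Fact p.Prime] {n : ℕ} {K : Type*} [NormedField K]
    [NormedAlgebra ℚ_[p] K] (s : ℂ) (θ : ℚ_[p] →*₀ ℂ) (F : SphereDistribution p n K)
    (f : BSDistribution K) : Prop :=
  ¬ IsExceptional n s θ ∧
  ∀ φ : BSTestFunction K, ∃ G : ℂ → ℂ,
    AnalyticOnNhd ℂ G {z | ¬ IsExceptional n z θ} ∧
    (∀ z : ℂ, -(n : ℝ) < z.re →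
      IntegrableOn (radialIntegrand F θ φ z) (padicPos p) (padicHaar p) ∧
      G z = (p : ℂ) ^ (1 - (n : ℤ)) * ((p : ℂ) ^ n - 1) *
        ∫ r in padicPos p, radialIntegrand F θ φ z r ∂(padicHaar p)) ∧
    f φ = G s

end

/-! Write `S` for the group of principal units of `ℚ_p`, `O` for the ring of integers of `K`, and `w
= |p|^(s+n)`. Since `K` is unramified, every nonzero element of `K` has the norm of a power of `p`.
So `K \ {0}` is the disjoint union of the dilates `p^ν O^×`, and everything reduces to the unit
sphere `O^×`.

The map `(r, ω, ξ) ↦ r ω ξ` is a homeomorphism from `S × Z_n` onto `O^×`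
(`exists_sphere_homeomorph`). The root of unity `ω` is the Teichmüller representative. Because `N(r)
= r^n` and `p ∤ n`, the factor `r` is the unique `n`-th root in `S` of the norm of the remaining
principal unit. Homogeneity under `S` says that `f`, restricted to functions on `O^×`, transforms
under translations of `S` by `θ⁻¹`. After a twist by `θ⁻¹` it becomes invariant, and an invariant
functional factors through averaging over `S` (`invariant_functional_eq_integral`). No continuity of
`f` is needed, as a locally constant function on a compact space takes finitely many values and only
finitely many cosets occur. This produces `F` (`equivariant_functional_eq_integral`).

It remains to pass from `O^×` to `K`. A test function is a finite sum of pieces on shells plus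
`φ(0)` times the indicator of `p^M O` (`testFunction_eq_sum_shells`). On the shells homogeneity
under `p` gives the factors `w^ν`. From `O = O^× ⊔ pO` one gets `f(1_O) (1 - w) = f(1_{O^×})`. The
radial integral has the same shape: finitely many shells plus a geometric series of ratio
`|p|^(z+n)`, whose sum is its own continuation (`radialIntegral_eq`). If `θ` is trivial on `S`,
non-exceptionality means `w ≠ 1` and the two tails agree. If `θ` is nontrivial on `S`, both tails
vanish and there is no pole. -/

/-! ### Invariant functionals on locally constant functions -/

section Averaging

variable {S Z : Type*} [CommGroup S] [TopologicalSpace S] [IsTopologicalGroup S] [CompactSpace S]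
  [TopologicalSpace Z] [CompactSpace Z]

/-- Translation by `t` in the first variable. -/
def translateFst (Z : Type*) [TopologicalSpace Z] (t : S) : C(S × Z, S × Z) :=
  ⟨fun x => (t * x.1, x.2), by fun_prop⟩

/-- A function on `Z`, viewed as a function on `S × Z`. -/
def constFst (S : Type*) [TopologicalSpace S] (ψ : LocallyConstant Z ℂ) :
    LocallyConstant (S × Z) ℂ :=
  ψ.comap ⟨Prod.snd, continuous_snd⟩

/-- The restriction of `g` to `{r} × Z`. -/
def sliceFst (g : LocallyConstant (S × Z) ℂ) (r : S) : LocallyConstant Z ℂ :=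
  g.comap ⟨fun η => (r, η), by fun_prop⟩

/-- The stabilizer of `g` is a subgroup, so it is open once it contains a neighbourhood of `1`.
Compactness of `S × Z` supplies one through the tube lemma. -/
theorem exists_isOpen_subgroup_invariant (g : LocallyConstant (S × Z) ℂ) :
    ∃ H : Subgroup S, IsOpen (H : Set S) ∧ ∀ h ∈ H, ∀ r η, g (h * r, η) = g (r, η) := by
  let H : Subgroup S :=
    { carrier := {h | ∀ r η, g (h * r, η) = g (r, η)}
      mul_mem' := fun {a b} ha hb r η => by rw [mul_assoc, ha, hb]
      one_mem' := fun r η => by rw [one_mul]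
      inv_mem' := fun {a} ha r η => by rw [← ha (a⁻¹ * r), mul_inv_cancel_left] }
  refine ⟨H, H.isOpen_of_mem_nhds (g := 1) ?_, fun h hh => hh⟩
  have hopen : IsOpen {y : S × (S × Z) | g (y.1 * y.2.1, y.2.2) = g y.2} := by
    have h1 : IsLocallyConstant (fun y : S × (S × Z) => g (y.1 * y.2.1, y.2.2) - g y.2) :=
      (g.isLocallyConstant.comp_continuous
        (f := fun y : S × (S × Z) => (y.1 * y.2.1, y.2.2)) (by fun_prop)).sub
        (g.isLocallyConstant.comp_continuous continuous_snd)
    simpa [sub_eq_zero] using h1.isOpen_fiber 0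
  obtain ⟨U, V, hU, -, hU1, hV, hUV⟩ := generalized_tube_lemma (s := {(1 : S)})
    isCompact_singleton (t := (Set.univ : Set (S × Z))) isCompact_univ hopen
    (by rintro ⟨a, b⟩ ⟨rfl, -⟩; simp)
  filter_upwards [hU.mem_nhds (hU1 rfl)] with h hh r η
  exact hUV (Set.mk_mem_prod hh (hV (Set.mem_univ (r, η))))

/-- A functional on the locally constant functions on `S × Z` that is invariant under translations
of the compact group `S` factors through averaging over `S`. -/
theorem invariant_functional_eq_integral [MeasurableSpace S] [BorelSpace S] (ν : Measure S)
    [ν.IsMulLeftInvariant] [IsFiniteMeasure ν] (L : LocallyConstant (S × Z) ℂ →ₗ[ℂ] ℂ)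
    (hL : ∀ t g, L (g.comap (translateFst Z t)) = L g) (g : LocallyConstant (S × Z) ℂ) :
    (ν.real Set.univ : ℂ) * L g = ∫ r, L (constFst S (sliceFst g r)) ∂ν := by
  classical
  obtain ⟨H, hH, hg⟩ := exists_isOpen_subgroup_invariant g
  have hdisc : DiscreteTopology (S ⧸ H) := QuotientGroup.discreteTopology hH
  have : Finite (S ⧸ H) := finite_of_compact_of_discrete
  have := Fintype.ofFinite (S ⧸ H)
  let ind (c : S ⧸ H) : LocallyConstant (S × Z) ℂ :=
    ⟨fun x => if (x.1 : S ⧸ H) = c then 1 else 0,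
      (IsLocallyConstant.of_discrete (fun d : S ⧸ H => if d = c then (1 : ℂ) else 0)).comp_continuous
        (f := fun x : S × Z => (x.1 : S ⧸ H)) (by fun_prop)⟩
  have hind (c : S ⧸ H) (x) : ind c x = if (x.1 : S ⧸ H) = c then 1 else 0 := rfl
  have hconst (ψ : LocallyConstant Z ℂ) (x : S × Z) : constFst S ψ x = ψ x.2 := rfl
  have hslice (r η) : sliceFst g r η = g (r, η) := rfl
  -- Slices depend only on the coset of `r`, so integration over `S` becomes a finite sum over `S ⧸
  -- H`.
  have hout (r : S) : sliceFst g ((r : S ⧸ H).out) = sliceFst g r := by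
    ext η
    have h1 : r⁻¹ * (r : S ⧸ H).out ∈ H :=
      QuotientGroup.eq.1 (QuotientGroup.out_eq' (r : S ⧸ H)).symm
    have h2 := hg _ h1 r η
    rwa [mul_right_comm, inv_mul_cancel, one_mul] at h2
  -- Translation by a representative of `c` carries the indicator of `c` to that of the trivial
  -- coset, so by invariance all cosets contribute equally.
  have hLind (c : S ⧸ H) (ψ : LocallyConstant Z ℂ) :
      L (ind c * constFst S ψ) = L (ind 1 * constFst S ψ) := by
    rw [← hL c.out]
    congr 1
    ext x
    have : ((c.out * x.1 : S) : S ⧸ H) = c ↔ (x.1 : S ⧸ H) = 1 := by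
      rw [QuotientGroup.mk_mul, QuotientGroup.out_eq']
      exact mul_eq_left
    change (if ((c.out * x.1 : S) : S ⧸ H) = c then (1 : ℂ) else 0) * ψ x.2
      = (if (x.1 : S ⧸ H) = 1 then 1 else 0) * ψ x.2
    simp only [this]
  have hsum : g = ∑ c, ind c * constFst S (sliceFst g c.out) := by
    ext x
    have h1 := congrArg (fun ψ => ψ x.2) (hout x.1)
    have h2 : (∑ c, ind c * constFst S (sliceFst g c.out)) x
        = ∑ c, (ind c x * sliceFst g c.out x.2) := by
      exact map_sum (LocallyConstant.evalₗ ℂ x) _ _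
    rw [h2]
    simp only [hind, ite_mul, one_mul, zero_mul, Finset.sum_ite_eq, Finset.mem_univ, if_true]
    exact h1.symm
  have hconstsum (ψ : LocallyConstant Z ℂ) : constFst S ψ = ∑ c, ind c * constFst S ψ := by
    rw [← Finset.sum_mul]
    ext x
    have h2 : (∑ c, ind c) x = ∑ c, ind c x := by
      exact map_sum (LocallyConstant.evalₗ ℂ x) ind Finset.univ
    rw [LocallyConstant.mul_apply, h2]
    simp [hind]
  have hLconst (ψ : LocallyConstant Z ℂ) :
      L (constFst S ψ) = Fintype.card (S ⧸ H) * L (ind 1 * constFst S ψ) := by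
    conv_lhs => rw [hconstsum ψ, map_sum]
    simp [hLind]
  have hmeas (c : S ⧸ H) : MeasurableSet {r : S | (r : S ⧸ H) = c} :=
    ((isOpen_discrete {c}).preimage QuotientGroup.continuous_mk).measurableSet
  have hν (c : S ⧸ H) : ν.real {r : S | (r : S ⧸ H) = c} = ν.real {r : S | (r : S ⧸ H) = 1} := by
    rw [Measure.real, Measure.real, ← measure_preimage_mul ν c.out]
    congr 2
    ext r
    change ((c.out * r : S) : S ⧸ H) = c ↔ (r : S ⧸ H) = 1
    rw [QuotientGroup.mk_mul, QuotientGroup.out_eq']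
    exact mul_eq_left
  have hint (k : S ⧸ H → ℂ) :
      ∫ r : S, k r ∂ν = ∑ c, (ν.real {r : S | (r : S ⧸ H) = 1} : ℂ) * k c := by
    have h1 : (fun r : S => k r)
        = fun r => ∑ c, Set.indicator {r : S | (r : S ⧸ H) = c} (fun _ => k c) r := by
      ext r
      simp [Set.indicator_apply]
    rw [h1, integral_finsetSum]
    · refine Finset.sum_congr rfl fun c _ => ?_
      rw [integral_indicator_const _ (hmeas c), hν c, Complex.real_smul]
    · exact fun c _ => (integrable_const _).indicator (hmeas c)
  have huniv : (ν.real Set.univ : ℂ)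
      = Fintype.card (S ⧸ H) * ν.real {r : S | (r : S ⧸ H) = 1} := by
    simpa using hint (fun _ => 1)
  have hint' := hint (fun c => L (constFst S (sliceFst g c.out)))
  simp only [hout] at hint'
  rw [hint', huniv]
  conv_lhs => rw [hsum, map_sum, Finset.mul_sum]
  refine Finset.sum_congr rfl fun c _ => ?_
  rw [hLind, hLconst]
  ring

end Averaging

/-! ### Principal units of an ultrametric field -/

section PrincipalUnits

variable {L : Type*} [NormedField L] [IsUltrametricDist L]

theorem norm_eq_one_of_norm_sub_one_lt {u : L} (h : ‖u - 1‖ < 1) : ‖u‖ = 1 := by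
  have h1 := IsUltrametricDist.norm_eq_of_add_norm_lt_max (x := u) (y := -1)
    (by rw [← sub_eq_add_neg, norm_neg, norm_one]; exact h.trans_le (le_max_right _ _))
  simpa using h1

theorem norm_mul_sub_one_le (u v : L) (hv : ‖v‖ ≤ 1) :
    ‖u * v - 1‖ ≤ max ‖u - 1‖ ‖v - 1‖ := by
  have h1 : u * v - 1 = (u - 1) * v + (v - 1) := by ring
  rw [h1]
  refine (IsUltrametricDist.norm_add_le_max _ _).trans (max_le_max ?_ le_rfl)
  rw [norm_mul]
  exact mul_le_of_le_one_right (norm_nonneg _) hv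

theorem norm_inv_sub_one {u : L} (h : ‖u - 1‖ < 1) : ‖u⁻¹ - 1‖ = ‖u - 1‖ := by
  have h1 := norm_eq_one_of_norm_sub_one_lt h
  have h0 : u ≠ 0 := by rintro rfl; simp at h1
  have h2 : u⁻¹ - 1 = -(u - 1) * u⁻¹ := by field_simp; ring
  rw [h2, norm_mul, norm_neg, norm_inv, h1, inv_one, mul_one]

theorem norm_pow_sub_one_le {u : L} (h : ‖u‖ ≤ 1) (m : ℕ) : ‖u ^ m - 1‖ ≤ ‖u - 1‖ := by
  induction m with
  | zero => simp
  | succ m ih =>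
    rw [pow_succ]
    exact (norm_mul_sub_one_le _ _ h).trans (max_le ih le_rfl)

theorem norm_geom_sum_sub_natCast_le {u : L} (h : ‖u‖ ≤ 1) (m : ℕ) :
    ‖(∑ i ∈ Finset.range m, u ^ i) - m‖ ≤ ‖u - 1‖ := by
  have h1 : (∑ i ∈ Finset.range m, u ^ i) - m = ∑ i ∈ Finset.range m, (u ^ i - 1) := by
    simp
  rw [h1]
  exact IsUltrametricDist.norm_sum_le_of_forall_le_of_nonneg (norm_nonneg _)
    fun i _ => norm_pow_sub_one_le h i

/-- In `u ^ m - 1 = (u - 1) * ∑ u ^ i` the sum is congruent to `m` modulo `u - 1`, hence has norm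
one. This makes `m`-th powers injective on principal units, applied with `m = q - 1` for `ω` and `m
= n` for `r`. -/
theorem norm_pow_sub_one_eq {u : L} (h : ‖u - 1‖ < 1) {m : ℕ} (hm : ‖(m : L)‖ = 1) :
    ‖u ^ m - 1‖ = ‖u - 1‖ := by
  have h1 := norm_eq_one_of_norm_sub_one_lt h
  have h2 : ‖∑ i ∈ Finset.range m, u ^ i‖ = 1 := by
    rw [← hm]
    have h3 := IsUltrametricDist.norm_eq_of_add_norm_lt_max (x := ∑ i ∈ Finset.range m, u ^ i)
      (y := -(m : L)) (by
        rw [← sub_eq_add_neg, norm_neg, hm]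
        exact ((norm_geom_sum_sub_natCast_le h1.le m).trans_lt h).trans_le (le_max_right _ _))
    simpa using h3
  rw [← mul_geom_sum, norm_mul, h2, mul_one]

theorem eq_one_of_pow_eq_one {u : L} (h : ‖u - 1‖ < 1) {m : ℕ} (hm : ‖(m : L)‖ = 1)
    (hu : u ^ m = 1) : u = 1 := by
  have := norm_pow_sub_one_eq h hm
  rw [hu, sub_self, norm_zero] at this
  exact sub_eq_zero.1 (norm_eq_zero.1 this.symm)

/-- The powers `u ^ (p ^ k)` of a principal unit converge to `1`. -/
theorem tendsto_pow_prime_pow {u : L} (h : ‖u - 1‖ < 1) {p : ℕ} (hp : ‖(p : L)‖ < 1) :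
    Filter.Tendsto (fun k : ℕ => u ^ p ^ k) Filter.atTop (nhds 1) := by
  set c := max ‖(p : L)‖ ‖u - 1‖ with hc
  have hc1 : c < 1 := max_lt hp h
  have hc0 : 0 ≤ c := (norm_nonneg _).trans (le_max_left _ _)
  have hu := norm_eq_one_of_norm_sub_one_lt h
  -- Each further `p`-th power multiplies the distance to `1` by a geometric sum congruent to `p`
  -- modulo `u ^ p ^ k - 1`, hence of norm at most `c`.
  have key (k : ℕ) : ‖u ^ p ^ k - 1‖ ≤ c ^ k := by
    induction k with
    | zero => simpa using h.le
    | succ k ih =>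
      have hv : ‖u ^ p ^ k‖ ≤ 1 := by simp [hu]
      have hv1 : ‖u ^ p ^ k - 1‖ ≤ c :=
        (norm_pow_sub_one_le hu.le _).trans (le_max_right _ _)
      have h3 : ‖∑ i ∈ Finset.range p, (u ^ p ^ k) ^ i‖ ≤ c := by
        have h4 := IsUltrametricDist.norm_add_le_max
          ((∑ i ∈ Finset.range p, (u ^ p ^ k) ^ i) - p) (p : L)
        rw [sub_add_cancel] at h4
        exact h4.trans (max_le ((norm_geom_sum_sub_natCast_le hv p).trans hv1) (le_max_left _ _))
      rw [pow_succ p, pow_mul, ← mul_geom_sum, norm_mul, pow_succ]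
      exact mul_le_mul ih h3 (norm_nonneg _) (pow_nonneg hc0 _)
  rw [tendsto_iff_norm_sub_tendsto_zero]
  exact squeeze_zero (fun _ => norm_nonneg _) key (tendsto_pow_atTop_nhds_zero_of_lt_one hc0 hc1)

end PrincipalUnits

/-! ### The group of principal units of `ℚ_p` -/

section Padic

variable (p : ℕ) [Fact p.Prime]

/-- The principal units `1 + p ℤ_p`. -/
def padicUnits : Submonoid ℚ_[p] where
  carrier := {r | ‖r - 1‖ < 1}
  mul_mem' := fun {a b} ha hb =>
    (norm_mul_sub_one_le a b (norm_eq_one_of_norm_sub_one_lt hb).le).trans_lt (max_lt ha hb)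
  one_mem' := by simp

variable {p}

theorem mem_padicUnits {r : ℚ_[p]} : r ∈ padicUnits p ↔ ‖r - 1‖ < 1 := Iff.rfl

theorem padicUnits_norm (r : padicUnits p) : ‖(r : ℚ_[p])‖ = 1 :=
  norm_eq_one_of_norm_sub_one_lt r.2

theorem padicUnits_ne_zero (r : padicUnits p) : (r : ℚ_[p]) ≠ 0 :=
  norm_ne_zero_iff.1 (by rw [padicUnits_norm]; exact one_ne_zero)

noncomputable instance : CommGroup (padicUnits p) :=
  { (inferInstance : CommMonoid (padicUnits p)) with
    inv := fun r => ⟨(r : ℚ_[p])⁻¹, by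
      rw [mem_padicUnits, norm_inv_sub_one r.2]; exact r.2⟩
    inv_mul_cancel := fun r => Subtype.ext (inv_mul_cancel₀ (padicUnits_ne_zero r)) }

theorem padicUnits_coe_inv (r : padicUnits p) : ((r⁻¹ : padicUnits p) : ℚ_[p]) = (r : ℚ_[p])⁻¹ :=
  rfl

instance : IsTopologicalGroup (padicUnits p) where
  continuous_inv := by
    refine Continuous.subtype_mk (f := fun r : padicUnits p => (r : ℚ_[p])⁻¹) ?_ _
    exact continuous_subtype_val.inv₀ padicUnits_ne_zero

theorem padicUnits_coe_eq_ball : (padicUnits p : Set ℚ_[p]) = Metric.ball 1 1 := by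
  ext r
  simp [mem_padicUnits, dist_eq_norm]

theorem isOpen_padicUnits : IsOpen (padicUnits p : Set ℚ_[p]) := by
  rw [padicUnits_coe_eq_ball]; exact Metric.isOpen_ball

theorem measurableSet_padicUnits : MeasurableSet (padicUnits p : Set ℚ_[p]) :=
  isOpen_padicUnits.measurableSet

theorem isCompact_padicUnits : IsCompact (padicUnits p : Set ℚ_[p]) := by
  rw [padicUnits_coe_eq_ball]
  exact Metric.isCompact_of_isClosed_isBounded (IsUltrametricDist.isClosed_ball _ _)
    Metric.isBounded_ball

instance : CompactSpace (padicUnits p) := isCompact_iff_compactSpace.1 isCompact_padicUnits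

/-- `ℂ^*` has no small subgroups: while the iterated squares stay near `1`, each squaring multiplies
the distance to `1` by `|z ^ 2 ^ k + 1| ≥ 3/2`. -/
theorem eq_one_of_forall_norm_pow_sub_one_le {z : ℂ} (h : ∀ k : ℕ, ‖z ^ 2 ^ k - 1‖ ≤ 1 / 2) :
    z = 1 := by
  by_contra hz
  have hz' : 0 < ‖z - 1‖ := norm_pos_iff.2 (sub_ne_zero.2 hz)
  have key (k : ℕ) : (3 / 2) ^ k * ‖z - 1‖ ≤ ‖z ^ 2 ^ k - 1‖ := by
    induction k with
    | zero => simp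
    | succ k ih =>
      have h1 : z ^ 2 ^ (k + 1) - 1 = (z ^ 2 ^ k + 1) * (z ^ 2 ^ k - 1) := by ring
      have h2 : (3 / 2 : ℝ) ≤ ‖z ^ 2 ^ k + 1‖ := by
        have h3 := norm_sub_le (z ^ 2 ^ k + 1) (z ^ 2 ^ k - 1)
        have h4 : z ^ 2 ^ k + 1 - (z ^ 2 ^ k - 1) = 2 := by ring
        rw [h4, Complex.norm_ofNat] at h3
        linarith [h k]
      rw [h1, norm_mul, pow_succ', mul_assoc]
      exact mul_le_mul h2 ih (by positivity) (norm_nonneg _)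
  obtain ⟨k, hk⟩ := pow_unbounded_of_one_lt (1 / ‖z - 1‖) (by norm_num : (1 : ℝ) < 3 / 2)
  have := (key k).trans (h k)
  rw [div_lt_iff₀ hz'] at hk
  linarith

/-- Powers of a principal unit `r` are at least as close to `1` as `r` itself. So near `1` all
values `θ(r) ^ 2 ^ k` stay close to `1`, which forces `θ(r) = 1`; translation carries this to every
point. -/
theorem isLocallyConstant_character (θ : ℚ_[p] →*₀ ℂ) (hθ : ContinuousOn θ {0}ᶜ) :
    IsLocallyConstant (fun r : padicUnits p => θ r) := by
  have h1 : ∀ᶠ r : padicUnits p in nhds 1, θ (r : ℚ_[p]) = 1 := by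
    have hc : ContinuousAt θ 1 := hθ.continuousAt (isOpen_compl_singleton.mem_nhds (by simp))
    obtain ⟨ε, hε, h⟩ := Metric.continuousAt_iff.1 hc (1 / 2) (by norm_num)
    have h2 : ∀ᶠ r : padicUnits p in nhds 1, dist r 1 < ε := Metric.ball_mem_nhds _ hε
    filter_upwards [h2] with r hr
    refine eq_one_of_forall_norm_pow_sub_one_le fun k => ?_
    have h3 : dist ((r : ℚ_[p]) ^ 2 ^ k) 1 < ε := by
      rw [dist_eq_norm]
      refine (norm_pow_sub_one_le (padicUnits_norm r).le _).trans_lt ?_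
      simpa [dist_eq_norm, Subtype.dist_eq] using hr
    have h4 := h h3
    rw [map_one, map_pow, dist_eq_norm] at h4
    exact h4.le
  rw [IsLocallyConstant.iff_eventually_eq]
  intro r
  have h2 : Filter.Tendsto (fun t : padicUnits p => t * r⁻¹) (nhds r) (nhds 1) := by
    have : Continuous (fun t : padicUnits p => t * r⁻¹) := by fun_prop
    simpa using this.tendsto r
  filter_upwards [h2.eventually h1] with t ht
  have h3 : θ t = θ ((t * r⁻¹ : padicUnits p) : ℚ_[p]) * θ r := by
    rw [← map_mul, ← Submonoid.coe_mul, inv_mul_cancel_right]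
  rw [h3, ht, one_mul]

end Padic

/-! ### Scaling of the Haar measure of `ℚ_p` -/

section PadicHaar

open scoped Pointwise

variable {p : ℕ} [Fact p.Prime]

instance : (padicHaar p).IsAddHaarMeasure :=
  inferInstanceAs (Measure.addHaarMeasure (padicUnitBall p)).IsAddHaarMeasure

instance : (padicHaar p).Regular :=
  inferInstanceAs (Measure.addHaarMeasure (padicUnitBall p)).Regular

theorem padicHaar_closedBall : padicHaar p (Metric.closedBall 0 1) = 1 :=
  Measure.addHaarMeasure_self (K₀ := padicUnitBall p)

/-- `ℤ_p` is the disjoint union of the `p` translates of its maximal ideal by `0, …, p - 1`. -/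
theorem padicHaar_ball : (p : ENNReal) * padicHaar p (Metric.ball 0 1) = 1 := by
  have hcover : (Metric.closedBall 0 1 : Set ℚ_[p])
      = ⋃ i ∈ Finset.range p, (fun x => -(i : ℚ_[p]) + x) ⁻¹' Metric.ball 0 1 := by
    ext x
    simp only [mem_closedBall_zero_iff, Set.mem_iUnion, Set.mem_preimage, mem_ball_zero_iff,
      Finset.mem_range, exists_prop]
    constructor
    · intro hx
      obtain ⟨i, hi, h⟩ := PadicInt.exists_mem_range (p := p) ⟨x, hx⟩
      refine ⟨i, hi, ?_⟩
      rw [IsLocalRing.mem_maximalIdeal, PadicInt.mem_nonunits, PadicInt.norm_def] at h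
      rwa [neg_add_eq_sub]
    · rintro ⟨i, -, h⟩
      have h1 := IsUltrametricDist.norm_add_le_max (i : ℚ_[p]) (-(i : ℚ_[p]) + x)
      rw [add_neg_cancel_left] at h1
      exact h1.trans (max_le (IsUltrametricDist.norm_natCast_le_one _ _) h.le)
  have hdisj : Set.PairwiseDisjoint (↑(Finset.range p))
      (fun i : ℕ => (fun x => -(i : ℚ_[p]) + x) ⁻¹' Metric.ball (0 : ℚ_[p]) 1) := by
    intro i hi j hj hij
    refine Set.disjoint_left.2 fun x hx hx' => hij ?_
    simp only [Set.mem_preimage, mem_ball_zero_iff] at hx hx'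
    have h1 := IsUltrametricDist.norm_add_le_max (-(i : ℚ_[p]) + x) (-(-(j : ℚ_[p]) + x))
    rw [norm_neg, ← sub_eq_add_neg] at h1
    have h2 : -(i : ℚ_[p]) + x - (-(j : ℚ_[p]) + x) = (((j : ℤ) - i : ℤ) : ℚ_[p]) := by
      push_cast; ring
    rw [h2] at h1
    have h3 : (p : ℤ) ∣ (j : ℤ) - i := by
      rw [← Padic.norm_intCast_lt_one_iff]
      exact h1.trans_lt (max_lt hx hx')
    rw [Finset.coe_range, Set.mem_Iio] at hi hj
    have h4 : (j : ℤ) - i = 0 := Int.eq_zero_of_abs_lt_dvd h3 (by rw [abs_lt]; omega)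
    omega
  have h1 := padicHaar_closedBall (p := p)
  rw [hcover, measure_biUnion_finset hdisj
    fun i _ => (measurable_const_add _) Metric.isOpen_ball.measurableSet] at h1
  simpa only [measure_preimage_add, Finset.sum_const, Finset.card_range, nsmul_eq_mul] using h1

/-- Both sides are multiplicative, so it suffices to test units, which preserve `ℤ_p`, and `p`,
which maps `ℤ_p` onto the open unit ball. -/
theorem distribHaarChar_padic (t : ℚ_[p]ˣ) : distribHaarChar ℚ_[p] t = ‖(t : ℚ_[p])‖₊ := by
  have hball0 : padicHaar p (Metric.closedBall 0 1) ≠ 0 := by simp [padicHaar_closedBall]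
  have hballt : padicHaar p (Metric.closedBall 0 1) ≠ ⊤ := by simp [padicHaar_closedBall]
  have hp0 : (p : ℚ_[p]) ≠ 0 := by exact_mod_cast (Fact.out : p.Prime).ne_zero
  have hunit (u : ℚ_[p]ˣ) (hu : ‖(u : ℚ_[p])‖ = 1) : distribHaarChar ℚ_[p] u = 1 := by
    refine distribHaarChar_eq_of_measure_smul_eq_mul hball0 hballt ?_
    rw [ENNReal.coe_one, one_mul]
    congr 1
    ext x
    rw [Set.mem_smul_set_iff_inv_smul_mem]
    simp [Units.smul_def, hu]
  have hprime : distribHaarChar ℚ_[p] (Units.mk0 (p : ℚ_[p]) hp0) = (p : NNReal)⁻¹ := by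
    refine distribHaarChar_eq_of_measure_smul_eq_mul hball0 hballt ?_
    have h1 : (Units.mk0 (p : ℚ_[p]) hp0) • (Metric.closedBall 0 1 : Set ℚ_[p])
        = Metric.ball 0 1 := by
      ext x
      rw [Set.mem_smul_set_iff_inv_smul_mem]
      simp only [Units.smul_def, Units.val_inv_eq_inv_val, Units.val_mk0, mem_closedBall_zero_iff,
        mem_ball_zero_iff, norm_smul, norm_inv, Padic.norm_p, inv_inv]
      have h2 := Padic.norm_le_pow_iff_norm_lt_pow_add_one x (-1)
      simp only [zpow_neg_one, Int.reduceNeg, neg_add_cancel, zpow_zero] at h2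
      have h3 : (0 : ℝ) < p := by exact_mod_cast (Fact.out : p.Prime).pos
      rw [← h2, ← le_div_iff₀' h3, one_div]
    rw [h1, padicHaar_closedBall, mul_one, ENNReal.coe_inv (by exact_mod_cast
      (Fact.out : p.Prime).ne_zero), ENNReal.coe_natCast]
    exact ENNReal.eq_inv_of_mul_eq_one_left (by rw [mul_comm]; exact padicHaar_ball)
  set P := Units.mk0 (p : ℚ_[p]) hp0
  have hval : ‖((P ^ (-(t : ℚ_[p]).valuation) * t : ℚ_[p]ˣ) : ℚ_[p])‖ = 1 := by
    have h3 : (p : ℝ) ≠ 0 := by exact_mod_cast (Fact.out : p.Prime).ne_zero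
    simp [P, Padic.norm_eq_zpow_neg_valuation t.ne_zero, mul_inv_cancel₀ (zpow_ne_zero _ h3)]
  have h1 := hunit _ hval
  rw [map_mul, map_zpow, hprime] at h1
  have h2 : (p : NNReal) ≠ 0 := by exact_mod_cast (Fact.out : p.Prime).ne_zero
  have h3 : distribHaarChar ℚ_[p] t = (p : NNReal) ^ (-(t : ℚ_[p]).valuation) := by
    rw [inv_zpow', neg_neg] at h1
    rw [zpow_neg]
    exact eq_inv_of_mul_eq_one_right h1
  rw [h3]
  ext
  simp [Padic.norm_eq_zpow_neg_valuation t.ne_zero]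

theorem padicHaar_smul_set {t : ℚ_[p]} (ht : t ≠ 0) (A : Set ℚ_[p]) :
    padicHaar p (t • A) = ‖t‖₊ * padicHaar p A := by
  have h := distribHaarChar_mul (padicHaar p) (Units.mk0 t ht) A
  rw [distribHaarChar_padic] at h
  exact h.symm

theorem map_mul_padicHaar {t : ℚ_[p]} (ht : t ≠ 0) :
    padicHaar p = ‖t‖₊ • (padicHaar p).map (fun x => t * x) := by
  ext A hA
  have h1 : (fun x => t * x) ⁻¹' A = t⁻¹ • A := by
    ext x
    rw [Set.mem_smul_set_iff_inv_smul_mem₀ (inv_ne_zero ht), inv_inv]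
    rfl
  rw [Measure.smul_apply, Measure.map_apply (measurable_const_mul t) hA, h1,
    padicHaar_smul_set (inv_ne_zero ht), ENNReal.smul_def, smul_eq_mul, ← mul_assoc,
    ← ENNReal.coe_mul, nnnorm_inv, mul_inv_cancel₀ (nnnorm_ne_zero_iff.2 ht), ENNReal.coe_one,
    one_mul]

theorem measurableEmbedding_mul_padic {t : ℚ_[p]} (ht : t ≠ 0) :
    MeasurableEmbedding (fun x : ℚ_[p] => t * x) :=
  (Homeomorph.mulLeft₀ t ht).measurableEmbedding

theorem setIntegral_padicHaar_smul {E : Type*} [NormedAddCommGroup E] [NormedSpace ℝ E]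
    {t : ℚ_[p]} (ht : t ≠ 0) (A : Set ℚ_[p]) (I : ℚ_[p] → E) :
    ∫ r in t • A, I r ∂(padicHaar p) = ‖t‖ • ∫ r in A, I (t * r) ∂(padicHaar p) := by
  have h1 : (fun x => t * x) ⁻¹' (t • A) = A :=
    Set.preimage_image_eq A (mul_right_injective₀ ht)
  conv_lhs => rw [map_mul_padicHaar ht]
  rw [Measure.restrict_smul, integral_smul_nnreal_measure,
    (measurableEmbedding_mul_padic ht).setIntegral_map, h1]
  rfl

theorem integrableOn_padicHaar_smul {E : Type*} [NormedAddCommGroup E]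
    {t : ℚ_[p]} (ht : t ≠ 0) (A : Set ℚ_[p]) (I : ℚ_[p] → E)
    (h : IntegrableOn (fun r => I (t * r)) A (padicHaar p)) :
    IntegrableOn I (t • A) (padicHaar p) := by
  have h1 : (fun x => t * x) ⁻¹' (t • A) = A :=
    Set.preimage_image_eq A (mul_right_injective₀ ht)
  rw [map_mul_padicHaar ht, IntegrableOn, Measure.restrict_smul]
  refine Integrable.smul_measure_nnreal ?_
  rw [← IntegrableOn, (measurableEmbedding_mul_padic ht).integrableOn_map_iff, h1]
  exact h

/-- The Haar measure `dr` on the group of principal units. -/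
noncomputable def padicUnitsHaar (p : ℕ) [Fact p.Prime] : Measure (padicUnits p) :=
  (padicHaar p).comap Subtype.val

theorem measurableEmbedding_padicUnits_coe :
    MeasurableEmbedding (Subtype.val : padicUnits p → ℚ_[p]) :=
  MeasurableEmbedding.subtype_coe measurableSet_padicUnits

theorem padicUnitsHaar_apply (A : Set (padicUnits p)) :
    padicUnitsHaar p A = padicHaar p (Subtype.val '' A) :=
  measurableEmbedding_padicUnits_coe.comap_apply _ _

instance : IsFiniteMeasure (padicUnitsHaar p) := by
  constructor
  rw [padicUnitsHaar_apply, Set.image_univ, Subtype.range_coe]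
  exact isCompact_padicUnits.measure_lt_top

theorem padicUnitsHaar_real_univ_ne_zero : (padicUnitsHaar p).real Set.univ ≠ 0 := by
  rw [Measure.real, ENNReal.toReal_ne_zero]
  refine ⟨?_, measure_ne_top _ _⟩
  rw [padicUnitsHaar_apply, Set.image_univ, Subtype.range_coe]
  exact (isOpen_padicUnits.measure_pos _ ⟨1, one_mem _⟩).ne'

instance : (padicUnitsHaar p).IsMulLeftInvariant := by
  constructor
  intro t
  ext A hA
  rw [Measure.map_apply (measurable_const_mul t) hA, padicUnitsHaar_apply, padicUnitsHaar_apply]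
  have h1 : Subtype.val '' ((fun x => t * x) ⁻¹' A) = (t : ℚ_[p])⁻¹ • (Subtype.val '' A) := by
    ext x
    rw [Set.mem_smul_set_iff_inv_smul_mem₀ (inv_ne_zero (padicUnits_ne_zero t)), inv_inv]
    constructor
    · rintro ⟨y, hy, rfl⟩
      exact ⟨_, hy, rfl⟩
    · rintro ⟨y, hy, hxy⟩
      refine ⟨t⁻¹ * y, by simpa using hy, ?_⟩
      rw [Submonoid.coe_mul, hxy, padicUnits_coe_inv, smul_eq_mul,
        inv_mul_cancel_left₀ (padicUnits_ne_zero t)]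
  rw [h1, padicHaar_smul_set (inv_ne_zero (padicUnits_ne_zero t)), nnnorm_inv]
  have h2 : ‖(t : ℚ_[p])‖₊ = 1 := by ext; exact padicUnits_norm t
  rw [h2, inv_one, ENNReal.coe_one, one_mul]

theorem integral_padicUnitsHaar {E : Type*} [NormedAddCommGroup E] [NormedSpace ℝ E]
    (I : ℚ_[p] → E) :
    ∫ r, I r ∂(padicUnitsHaar p) = ∫ r in (padicUnits p : Set ℚ_[p]), I r ∂(padicHaar p) :=
  integral_subtype_comap measurableSet_padicUnits I

/-! ### Shells -/

theorem padic_p_ne_zero : (p : ℚ_[p]) ≠ 0 := by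
  exact_mod_cast (Fact.out : p.Prime).ne_zero

theorem padicPos_eq_iUnion :
    padicPos p = ⋃ ν : ℤ, (p : ℚ_[p]) ^ ν • (padicUnits p : Set ℚ_[p]) := by
  ext x
  simp only [padicPos, Set.mem_ofPred_eq, Set.mem_iUnion, Set.mem_smul_set, smul_eq_mul,
    SetLike.mem_coe, mem_padicUnits]
  exact exists_congr fun ν => exists_congr fun u => and_congr_right fun _ => eq_comm

theorem norm_of_mem_shell {ν : ℤ} {x : ℚ_[p]}
    (hx : x ∈ (p : ℚ_[p]) ^ ν • (padicUnits p : Set ℚ_[p])) : ‖x‖ = ‖(p : ℚ_[p]) ^ ν‖ := by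
  obtain ⟨u, hu, rfl⟩ := hx
  change ‖(p : ℚ_[p]) ^ ν * u‖ = _
  rw [norm_mul, norm_eq_one_of_norm_sub_one_lt hu, mul_one]

theorem norm_padic_zpow_injective :
    Function.Injective fun ν : ℤ => ‖(p : ℚ_[p]) ^ ν‖ := by
  intro a b h
  simp only [Padic.norm_p_zpow] at h
  have h1 : (1 : ℝ) < p := by exact_mod_cast (Fact.out : p.Prime).one_lt
  exact neg_injective (zpow_right_injective₀ (by positivity) h1.ne' h)

theorem pairwise_disjoint_shells :
    Pairwise (Function.onFun Disjoint
      fun ν : ℤ => (p : ℚ_[p]) ^ ν • (padicUnits p : Set ℚ_[p])) := by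
  intro a b hab
  refine Set.disjoint_left.2 fun x hx hx' => hab (norm_padic_zpow_injective (p := p) ?_)
  exact (norm_of_mem_shell hx).symm.trans (norm_of_mem_shell hx')

theorem measurableSet_shell (ν : ℤ) :
    MeasurableSet ((p : ℚ_[p]) ^ ν • (padicUnits p : Set ℚ_[p])) :=
  (measurableEmbedding_mul_padic (zpow_ne_zero ν padic_p_ne_zero)).measurableSet_image.2
    measurableSet_padicUnits

end PadicHaar

/-! ### Arithmetic of the unramified extension -/

section Residue

open scoped NormedField Valued

variable {L : Type*} [NormedField L] [IsUltrametricDist L]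

theorem mem_integer_iff_norm_le_one {x : L} : x ∈ 𝒪[L] ↔ ‖x‖ ≤ 1 := by
  rw [Valuation.mem_integer_iff]
  exact Iff.rfl

theorem integer_isUnit_iff_norm_eq_one {x : 𝒪[L]} : IsUnit x ↔ ‖(x : L)‖ = 1 := by
  rw [(Valuation.integer.integers (NormedField.valuation (K := L))).isUnit_iff_valuation_eq_one,
    ← NNReal.coe_inj]
  exact Iff.rfl

theorem residue_eq_zero_iff_norm_lt_one {x : 𝒪[L]} :
    IsLocalRing.residue 𝒪[L] x = 0 ↔ ‖(x : L)‖ < 1 := by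
  rw [IsLocalRing.residue_eq_zero_iff, IsLocalRing.mem_maximalIdeal, mem_nonunits_iff,
    integer_isUnit_iff_norm_eq_one]
  exact ⟨fun h => lt_of_le_of_ne (mem_integer_iff_norm_le_one.1 x.2) h, fun h => h.ne⟩

theorem norm_pow_residue_card_sub_one_lt [Finite 𝓀[L]] {x : L} (hx : ‖x‖ = 1) :
    ‖x ^ (Nat.card 𝓀[L] - 1) - 1‖ < 1 := by
  have := Fintype.ofFinite 𝓀[L]
  let y : 𝒪[L] := ⟨x, mem_integer_iff_norm_le_one.2 hx.le⟩
  have hy : IsLocalRing.residue 𝒪[L] y ≠ 0 := by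
    rw [Ne, residue_eq_zero_iff_norm_lt_one]
    exact fun h => h.ne hx
  have h1 := FiniteField.pow_card_sub_one_eq_one _ hy
  rw [← Nat.card_eq_fintype_card] at h1
  rw [← map_pow, ← map_one (IsLocalRing.residue 𝒪[L]), ← sub_eq_zero, ← map_sub,
    residue_eq_zero_iff_norm_lt_one] at h1
  exact h1

end Residue

/-! ### Value group, Teichmüller representatives and norms of principal units -/

section Unramified

open scoped NormedField Valued

variable {p : ℕ} [Fact p.Prime] {n : ℕ} {K : Type*} [NormedField K] [NormedAlgebra ℚ_[p] K]

theorem norm_p_extension : ‖(p : K)‖ = (p : ℝ)⁻¹ := by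
  have h := norm_algebraMap' K (p : ℚ_[p])
  rwa [map_natCast, Padic.norm_p] at h

theorem norm_p_extension_lt_one : ‖(p : K)‖ < 1 := by
  rw [norm_p_extension (p := p)]
  exact inv_lt_one_of_one_lt₀ (by exact_mod_cast (Fact.out : p.Prime).one_lt)

theorem norm_natCast_extension_eq_one {m : ℕ} (hm : ¬ p ∣ m) : ‖(m : K)‖ = 1 := by
  have h := norm_algebraMap' K (m : ℚ_[p])
  rw [map_natCast] at h
  rw [h, Padic.norm_natCast_eq_one_iff]
  exact ((Fact.out : p.Prime).coprime_iff_not_dvd).2 hm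

/-- `N(p) = p ^ n`, so `|N(p)| = 1 / q` pins down `q`. -/
theorem residueCard_eq (hK : IsUnramifiedOverPadic p K) (b : Module.Basis (Fin n) ℚ_[p] K) :
    residueCard p K = p ^ n := by
  have h1 : Algebra.norm ℚ_[p] (p : K) = (p : ℚ_[p]) ^ n := by
    rw [← map_natCast (algebraMap ℚ_[p] K), Algebra.norm_algebraMap,
      Module.finrank_eq_card_basis b, Fintype.card_fin]
  rw [IsUnramifiedOverPadic, h1, norm_pow, Padic.norm_p, inv_pow, inv_inj] at hK
  exact_mod_cast hK.symm

variable [IsUltrametricDist K]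

theorem natCard_residueField (hK : IsUnramifiedOverPadic p K)
    (b : Module.Basis (Fin n) ℚ_[p] K) : Nat.card 𝓀[K] = p ^ n :=
  residueCard_eq hK b

theorem finite_residueField (hK : IsUnramifiedOverPadic p K)
    (b : Module.Basis (Fin n) ℚ_[p] K) : Finite 𝓀[K] := by
  refine Nat.finite_of_card_ne_zero ?_
  rw [natCard_residueField hK b]
  exact pow_ne_zero _ (Fact.out : p.Prime).ne_zero

theorem norm_pow_sub_one_lt_one (hK : IsUnramifiedOverPadic p K)
    (b : Module.Basis (Fin n) ℚ_[p] K) {x : K} (hx : ‖x‖ = 1) :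
    ‖x ^ (p ^ n - 1) - 1‖ < 1 := by
  have := finite_residueField hK b
  rw [← natCard_residueField hK b]
  exact norm_pow_residue_card_sub_one_lt hx

/-- The residue field has a family of `n` representatives that is orthonormal over `ℚ_p`. -/
theorem exists_orthonormal_family (hK : IsUnramifiedOverPadic p K)
    (b : Module.Basis (Fin n) ℚ_[p] K) :
    ∃ e : Fin n → K, ∀ c : Fin n → ℚ_[p], (∀ i, ‖c i‖ ≤ 1) → ∀ i₀, ‖c i₀‖ = 1 →
      ‖∑ i, c i • e i‖ = 1 := by
  have hfin := finite_residueField hK b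
  have hchar : CharP 𝓀[K] p := by
    refine (CharP.charP_iff_prime_eq_zero Fact.out).2 ?_
    rw [← map_natCast (IsLocalRing.residue 𝒪[K]), residue_eq_zero_iff_norm_lt_one]
    exact norm_p_extension_lt_one
  let _ : Algebra (ZMod p) 𝓀[K] := ZMod.algebra _ p
  have hrank : Module.finrank (ZMod p) 𝓀[K] = n := by
    have h1 := Module.natCard_eq_pow_finrank (K := ZMod p) (V := 𝓀[K])
    rw [natCard_residueField hK b, Nat.card_zmod] at h1
    exact (Nat.pow_right_injective (Fact.out : p.Prime).two_le h1).symm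
  let B := Module.finBasisOfFinrankEq (ZMod p) 𝓀[K] hrank
  choose e he using fun i => IsLocalRing.residue_surjective (R := 𝒪[K]) (B i)
  have hle (c : ℚ_[p]) (hc : ‖c‖ ≤ 1) (i : Fin n) : ‖c • (e i : K)‖ ≤ 1 := by
    rw [norm_smul]
    exact mul_le_one₀ hc (norm_nonneg _) (mem_integer_iff_norm_le_one.1 (e i).2)
  refine ⟨fun i => e i, fun c hc i₀ hi₀ => le_antisymm
    (IsUltrametricDist.norm_sum_le_of_forall_le_of_nonneg zero_le_one
      fun i _ => hle _ (hc i) i) (not_lt.1 fun hlt => ?_)⟩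
  -- Replacing each coefficient by an integer congruent to it modulo `p` changes the sum by
  -- something of norm below one. A sum of small norm would thus give a relation over `ZMod p` among
  -- the `B i`, with nonzero coefficient at `i₀`.
  choose m hm hmc using fun i => PadicInt.exists_mem_range (p := p) ⟨c i, hc i⟩
  have hmc' (i) : ‖c i - m i‖ < 1 := by
    have h := hmc i
    rwa [IsLocalRing.mem_maximalIdeal, PadicInt.mem_nonunits, PadicInt.norm_def] at h
  have hsmall : ‖((∑ i, (m i : 𝒪[K]) * e i : 𝒪[K]) : K)‖ < 1 := by
    have h1 : ((∑ i, (m i : 𝒪[K]) * e i : 𝒪[K]) : K)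
        = ∑ i, c i • (e i : K) + -∑ i, (c i - m i) • (e i : K) := by
      rw [← sub_eq_add_neg, ← Finset.sum_sub_distrib]
      push_cast
      refine Finset.sum_congr rfl fun i _ => ?_
      rw [← sub_smul, sub_sub_cancel, Algebra.smul_def, map_natCast]
    rw [h1]
    refine (IsUltrametricDist.norm_add_le_max _ _).trans_lt (max_lt hlt ?_)
    rw [norm_neg]
    have hne : (Finset.univ : Finset (Fin n)).Nonempty := ⟨i₀, Finset.mem_univ _⟩
    obtain ⟨j, -, hj⟩ := IsUltrametricDist.exists_norm_finsetSum_le_of_nonempty hne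
      (fun i => (c i - m i) • (e i : K))
    refine hj.trans_lt ?_
    rw [norm_smul]
    exact mul_lt_one_of_nonneg_of_lt_one_left (norm_nonneg _) (hmc' j)
      (mem_integer_iff_norm_le_one.1 (e j).2)
  rw [← residue_eq_zero_iff_norm_lt_one, map_sum] at hsmall
  have h2 : ∑ i, (m i : ZMod p) • B i = 0 := by
    rw [← hsmall]
    refine Finset.sum_congr rfl fun i _ => ?_
    rw [map_mul, map_natCast, he, Algebra.smul_def, map_natCast]
  have h3 := Fintype.linearIndependent_iff.1 B.linearIndependent _ h2 i₀
  rw [ZMod.natCast_eq_zero_iff] at h3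
  have h4 : ‖(m i₀ : ℚ_[p])‖ < 1 := Padic.norm_natCast_lt_one_iff.2 h3
  have h5 := IsUltrametricDist.norm_add_le_max (c i₀ - m i₀) (m i₀ : ℚ_[p])
  rw [sub_add_cancel, hi₀] at h5
  exact (h5.trans_lt (max_lt (hmc' i₀) h4)).false

/-- Dividing by the largest coefficient shows that `‖∑ c_i e_i‖ = max |c_i|`. Hence the `n` vectors
`e_i` are independent, span `K`, and `K` has the value group of `ℚ_p`. -/
theorem exists_norm_eq_padic_norm (hK : IsUnramifiedOverPadic p K)
    (b : Module.Basis (Fin n) ℚ_[p] K) (x : K) : ∃ a : ℚ_[p], ‖x‖ = ‖a‖ := by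
  obtain ⟨e, he⟩ := exists_orthonormal_family hK b
  have key (c : Fin n → ℚ_[p]) (hc : c ≠ 0) : ∃ i, c i ≠ 0 ∧ ‖∑ i, c i • e i‖ = ‖c i‖ := by
    obtain ⟨j, hj⟩ := Function.ne_iff.1 hc
    obtain ⟨i₀, -, hi₀⟩ := Finset.exists_max_image Finset.univ (fun i => ‖c i‖)
      ⟨j, Finset.mem_univ _⟩
    have h0 : c i₀ ≠ 0 :=
      norm_pos_iff.1 ((norm_pos_iff.2 hj).trans_le (hi₀ j (Finset.mem_univ _)))
    refine ⟨i₀, h0, ?_⟩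
    have h1 := he (fun i => c i / c i₀) (fun i => by
      rw [norm_div]
      exact div_le_one_of_le₀ (hi₀ i (Finset.mem_univ _)) (norm_nonneg _)) i₀ (by
      rw [div_self h0, norm_one])
    have h2 : ∑ i, c i • e i = c i₀ • ∑ i, (c i / c i₀) • e i := by
      rw [Finset.smul_sum]
      refine Finset.sum_congr rfl fun i _ => ?_
      rw [smul_smul, mul_div_cancel₀ _ h0]
    rw [h2, norm_smul, h1, mul_one]
  have hli : LinearIndependent ℚ_[p] e := by
    rw [Fintype.linearIndependent_iff]
    intro c hc
    by_contra! h
    obtain ⟨i, hi⟩ := h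
    obtain ⟨j, hj0, hj⟩ := key c (fun h => hi (congrFun h i))
    rw [hc, norm_zero] at hj
    exact hj0 (norm_eq_zero.1 hj.symm)
  have hspan : Submodule.span ℚ_[p] (Set.range e) = ⊤ := by
    have := Module.Finite.of_basis b
    refine hli.span_eq_top_of_card_eq_finrank' ?_
    rw [Module.finrank_eq_card_basis b]
  obtain ⟨c, hc⟩ := (Submodule.mem_span_range_iff_exists_fun ℚ_[p]).1
    (hspan ▸ Submodule.mem_top : x ∈ Submodule.span ℚ_[p] (Set.range e))
  by_cases h0 : c = 0
  · exact ⟨0, by simp [← hc, h0]⟩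
  · obtain ⟨i, -, hi⟩ := key c h0
    exact ⟨c i, by rw [← hc, hi]⟩

theorem exists_norm_eq_norm_zpow (hK : IsUnramifiedOverPadic p K)
    (b : Module.Basis (Fin n) ℚ_[p] K) {x : K} (hx : x ≠ 0) :
    ∃ ν : ℤ, ‖x‖ = ‖(p : ℚ_[p]) ^ ν‖ := by
  obtain ⟨a, ha⟩ := exists_norm_eq_padic_norm hK b x
  have ha0 : a ≠ 0 := by
    rintro rfl
    exact hx (norm_eq_zero.1 (ha.trans norm_zero))
  exact ⟨a.valuation, by rw [ha, Padic.norm_eq_zpow_neg_valuation ha0, Padic.norm_p_zpow]⟩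

omit [IsUltrametricDist K] in
theorem properSpace_extension (b : Module.Basis (Fin n) ℚ_[p] K) : ProperSpace K :=
  have := Module.Finite.of_basis b
  FiniteDimensional.proper ℚ_[p] K

/-- Every unit is congruent to a root of unity of degree `q - 1`. -/
theorem exists_root_of_unity (hK : IsUnramifiedOverPadic p K)
    (b : Module.Basis (Fin n) ℚ_[p] K) {x : K} (hx : ‖x‖ = 1) :
    ∃ ω : K, ω ^ (p ^ n - 1) = 1 ∧ ‖x - ω‖ < 1 := by
  have := properSpace_extension b
  have hpn : 0 < p ^ n := pow_pos (Fact.out : p.Prime).pos n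
  have hy := norm_pow_sub_one_lt_one hK b hx
  set y := x ^ (p ^ n - 1) with hy_def
  have hmem (k : ℕ) : x ^ (p ^ n) ^ k ∈ Metric.closedBall (0 : K) 1 := by simp [hx]
  -- The Teichmüller representative is taken as a limit point of `x ^ q ^ k`, `q = p ^ n`;
  -- compactness spares a Cauchy argument.
  obtain ⟨ω, -, φ, hφ, hlim⟩ := (isCompact_closedBall (0 : K) 1).tendsto_subseq hmem
  have hstep (k : ℕ) : ‖x ^ (p ^ n) ^ k - x‖ < 1 := by
    induction k with
    | zero => simp
    | succ k ih =>
      have h1 : x ^ (p ^ n) ^ (k + 1) - x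
          = x ^ (p ^ n) ^ k * (y ^ (p ^ n) ^ k - 1) + (x ^ (p ^ n) ^ k - x) := by
        rw [hy_def, ← pow_mul x, mul_sub, ← pow_add, mul_one, pow_succ (p ^ n) k]
        have h2 : (p ^ n) ^ k + (p ^ n - 1) * (p ^ n) ^ k = (p ^ n) ^ k * p ^ n := by
          rw [add_comm, ← Nat.succ_mul, Nat.succ_eq_add_one, Nat.sub_add_cancel hpn, mul_comm]
        rw [h2]
        ring
      rw [h1]
      refine (IsUltrametricDist.norm_add_le_max _ _).trans_lt (max_lt ?_ ih)
      rw [norm_mul, norm_pow, hx, one_pow, one_mul]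
      exact (norm_pow_sub_one_le (norm_eq_one_of_norm_sub_one_lt hy).le _).trans_lt hy
  refine ⟨ω, ?_, ?_⟩
  · have h1 : Filter.Tendsto (fun k => (x ^ (p ^ n) ^ φ k) ^ (p ^ n - 1)) Filter.atTop
        (nhds (ω ^ (p ^ n - 1))) := hlim.pow _
    have h2 : Filter.Tendsto (fun k => y ^ (p ^ n) ^ φ k) Filter.atTop (nhds 1) := by
      -- For `n = 0` the base `p ^ n` is `1`, but then `y = x ^ 0 = 1` and the limit is trivial.
      have h3 : ‖((p ^ n : ℕ) : K)‖ < 1 ∨ n = 0 := by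
        by_cases h : n = 0
        · exact Or.inr h
        · left
          rw [Nat.cast_pow, norm_pow]
          exact pow_lt_one₀ (norm_nonneg _) norm_p_extension_lt_one h
      rcases h3 with h3 | h3
      · exact (tendsto_pow_prime_pow hy h3).comp hφ.tendsto_atTop
      · simp [hy_def, h3]
    refine tendsto_nhds_unique h1 (h2.congr fun k => ?_)
    rw [hy_def, ← pow_mul x, ← pow_mul x, mul_comm]
  · have h1 : IsClosed {z : K | ‖x - z‖ < 1} := by
      have : {z : K | ‖x - z‖ < 1} = Metric.ball x 1 := by
        ext z; simp [dist_eq_norm, norm_sub_rev]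
      rw [this]
      exact IsUltrametricDist.isClosed_ball _ _
    refine h1.mem_of_tendsto hlim (Filter.Eventually.of_forall fun k => ?_)
    change ‖x - x ^ (p ^ n) ^ φ k‖ < 1
    rw [norm_sub_rev]
    exact hstep _

theorem continuous_algebra_norm (b : Module.Basis (Fin n) ℚ_[p] K) :
    Continuous (fun x : K => Algebra.norm ℚ_[p] x) := by
  have := Module.Finite.of_basis b
  simp_rw [Algebra.norm_eq_matrix_det b]
  refine Continuous.matrix_det ?_
  exact LinearMap.continuous_of_finiteDimensional (Algebra.leftMulMatrix b).toLinearMap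

/-- The norm of a principal unit is a principal unit. -/
theorem norm_algebra_norm_sub_one_lt (b : Module.Basis (Fin n) ℚ_[p] K) {u : K}
    (hu : ‖u - 1‖ < 1) : ‖Algebra.norm ℚ_[p] u - 1‖ < 1 := by
  set w := Algebra.norm ℚ_[p] u with hw
  -- By continuity of the norm map, `N(u) ^ p ^ k = N(u ^ p ^ k)` tends to `1`, so some such power
  -- is a principal unit. As Frobenius is the identity on `ZMod p`, `N(u)` itself has residue `1`.
  have h1 : Filter.Tendsto (fun k : ℕ => w ^ p ^ k) Filter.atTop (nhds 1) := by
    have h2 := ((continuous_algebra_norm b).tendsto 1).comp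
      (tendsto_pow_prime_pow hu (norm_p_extension_lt_one (p := p)))
    simpa [Function.comp_def, ← hw] using h2
  obtain ⟨k, hk⟩ := (h1.eventually (Metric.ball_mem_nhds 1 one_pos)).exists
  rw [dist_eq_norm] at hk
  have h3 := norm_eq_one_of_norm_sub_one_lt hk
  rw [norm_pow] at h3
  have h4 : ‖w‖ = 1 :=
    (pow_eq_one_iff_of_nonneg (norm_nonneg _) (pow_ne_zero _ (Fact.out : p.Prime).ne_zero)).1 h3
  let W : ℤ_[p] := ⟨w, h4.le⟩
  have hz (V : ℤ_[p]) : PadicInt.toZMod V = 0 ↔ ‖V‖ < 1 := by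
    rw [← RingHom.mem_ker, PadicInt.ker_toZMod, IsLocalRing.mem_maximalIdeal, PadicInt.mem_nonunits]
  have h5 : PadicInt.toZMod (W ^ p ^ k - 1) = 0 := (hz _).2 hk
  rw [map_sub, map_pow, ZMod.pow_card_pow, ← map_sub, hz] at h5
  exact h5

/-- If `n m_k ≡ 1` modulo `p ^ (k + 1)`, then `w ^ m_k` is an approximate `n`-th root, because `w ^
p ^ (k + 1) → 1`. A limit point is an exact root. The exponent `k + 1` keeps the modulus above `1`.
-/
theorem exists_padicUnits_pow_eq (hn : ¬ p ∣ n) (w : padicUnits p) :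
    ∃ r : padicUnits p, r ^ n = w := by
  have hcop (k : ℕ) : Nat.Coprime n (p ^ (k + 1)) :=
    (((Fact.out : p.Prime).coprime_iff_not_dvd.2 hn).pow_left _).symm
  choose m hm using fun k => Nat.exists_mul_mod_eq_one_of_coprime (hcop k)
    (Nat.one_lt_pow k.succ_ne_zero (Fact.out : p.Prime).one_lt)
  obtain ⟨r, -, φ, hφ, hlim⟩ := (isCompact_univ (X := padicUnits p)).tendsto_subseq
    (x := fun k => w ^ m k) fun _ => Set.mem_univ _
  refine ⟨r, ?_⟩
  have h1 : Filter.Tendsto (fun k => (w ^ m k) ^ n) Filter.atTop (nhds w) := by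
    rw [tendsto_subtype_rng, tendsto_iff_norm_sub_tendsto_zero]
    have h2 := (tendsto_pow_prime_pow w.2 (L := ℚ_[p]) Padic.norm_p_lt_one).comp
      (Filter.tendsto_add_atTop_nat 1)
    rw [tendsto_iff_norm_sub_tendsto_zero] at h2
    refine squeeze_zero (fun _ => norm_nonneg _) (fun k => ?_) h2
    have h3 := Nat.div_add_mod (n * m k) (p ^ (k + 1))
    rw [(hm k).2] at h3
    have h4 : (((w ^ m k) ^ n : padicUnits p) : ℚ_[p]) - w
        = (((w : ℚ_[p]) ^ p ^ (k + 1)) ^ (n * m k / p ^ (k + 1)) - 1) * w := by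
      rw [sub_mul, one_mul, ← pow_mul (w : ℚ_[p]), ← pow_succ, h3, ← pow_mul, mul_comm n]
      simp
    rw [h4, norm_mul, padicUnits_norm, mul_one]
    exact norm_pow_sub_one_le (by simp [padicUnits_norm]) _
  exact tendsto_nhds_unique (hlim.pow n) (h1.comp hφ.tendsto_atTop)

end Unramified

/-! ### The polar decomposition of the units of `K` -/

section Sphere

variable {p : ℕ} [Fact p.Prime] {n : ℕ} {K : Type*} [NormedField K] [NormedAlgebra ℚ_[p] K]
  [IsUltrametricDist K]

/-- `N(p ^ ν u) = p ^ (nν) N(u)` with `|N(u)| = 1`, so norm one forces `ν = 0`. -/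
theorem sigmaSet_eq (hn : n ≠ 0) (b : Module.Basis (Fin n) ℚ_[p] K) :
    sigmaSet p n K = {y | ‖y - 1‖ < 1 ∧ Algebra.norm ℚ_[p] y = 1} := by
  ext y
  constructor
  · rintro ⟨-, ⟨-, ν, u, hu, rfl⟩, hN⟩
    refine ⟨?_, hN⟩
    have h1 : (p : K) ^ ν = algebraMap ℚ_[p] K ((p : ℚ_[p]) ^ ν) := by simp
    rw [mul_one, h1, map_mul, Algebra.norm_algebraMap, Module.finrank_eq_card_basis b,
      Fintype.card_fin] at hN
    have h2 := congrArg norm hN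
    rw [norm_mul, norm_eq_one_of_norm_sub_one_lt (norm_algebra_norm_sub_one_lt b hu), mul_one,
      norm_one, norm_pow, pow_eq_one_iff_of_nonneg (norm_nonneg _) hn] at h2
    have h3 : ν = 0 := norm_padic_zpow_injective (p := p) (by simpa using h2)
    simpa [h3] using hu
  · rintro ⟨hy, hN⟩
    have hy0 : y ≠ 0 := norm_ne_zero_iff.1 (by
      rw [norm_eq_one_of_norm_sub_one_lt hy]; exact one_ne_zero)
    exact ⟨hy0, ⟨one_pow _, 0, y, hy, by simp⟩, hN⟩

theorem mem_sigmaSet_iff (hn : n ≠ 0) (b : Module.Basis (Fin n) ℚ_[p] K) {y : K} :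
    y ∈ sigmaSet p n K ↔ ‖y - 1‖ < 1 ∧ Algebra.norm ℚ_[p] y = 1 := by
  rw [sigmaSet_eq hn b]
  exact Iff.rfl

omit [NormedAlgebra ℚ_[p] K] [IsUltrametricDist K] in
theorem norm_eq_one_of_mem_muSet (hn : n ≠ 0) {ω : K} (h : ω ∈ muSet p n K) : ‖ω‖ = 1 := by
  have h1 := congrArg norm (show ω ^ (p ^ n - 1) = 1 from h)
  rw [norm_pow, norm_one] at h1
  refine (pow_eq_one_iff_of_nonneg (norm_nonneg _) ?_).1 h1
  have := Nat.one_lt_pow hn (Fact.out : p.Prime).one_lt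
  omega

theorem compactSpace_sphereZ (hn : n ≠ 0) (b : Module.Basis (Fin n) ℚ_[p] K) :
    CompactSpace (SphereZ p n K) := by
  have := properSpace_extension b
  have h1 : CompactSpace (muSet p n K) := by
    rw [← isCompact_iff_compactSpace]
    refine Metric.isCompact_of_isClosed_isBounded ?_
      ((Metric.isBounded_closedBall (x := (0 : K)) (r := 1)).subset fun ω hω => by
        simpa using (norm_eq_one_of_mem_muSet hn hω).le)
    exact isClosed_singleton.preimage (continuous_pow (p ^ n - 1))
  have h2 : CompactSpace (sigmaSet p n K) := by
    rw [← isCompact_iff_compactSpace, sigmaSet_eq hn b]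
    have h3 : {y : K | ‖y - 1‖ < 1 ∧ Algebra.norm ℚ_[p] y = 1}
        = Metric.ball 1 1 ∩ (fun y => Algebra.norm ℚ_[p] y) ⁻¹' {1} := by
      ext y; simp [dist_eq_norm]
    rw [h3]
    exact Metric.isCompact_of_isClosed_isBounded ((IsUltrametricDist.isClosed_ball _ _).inter
      (isClosed_singleton.preimage (continuous_algebra_norm b)))
      (Metric.isBounded_ball.subset Set.inter_subset_left)
  infer_instance

omit [IsUltrametricDist K] in
theorem norm_algebraMap_padicUnits_sub_one (r : padicUnits p) :
    ‖algebraMap ℚ_[p] K r - 1‖ < 1 := by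
  rw [← map_one (algebraMap ℚ_[p] K), ← map_sub, norm_algebraMap']
  exact r.2

theorem norm_smul_sphere (hn : n ≠ 0) (b : Module.Basis (Fin n) ℚ_[p] K)
    (x : padicUnits p × SphereZ p n K) :
    ‖(x.1 : ℚ_[p]) • ((x.2.1 : K) * (x.2.2 : K))‖ = 1 := by
  have h := (mem_sigmaSet_iff hn b).1 x.2.2.2
  rw [norm_smul, norm_mul, padicUnits_norm, norm_eq_one_of_mem_muSet hn x.2.1.2,
    norm_eq_one_of_norm_sub_one_lt h.1]
  norm_num

/-- The units of `K` are the product of the principal units of `ℚ_p` and `Z_n`. -/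
theorem exists_sphere_homeomorph (hn : ¬ p ∣ n) (hK : IsUnramifiedOverPadic p K)
    (b : Module.Basis (Fin n) ℚ_[p] K) :
    ∃ e : padicUnits p × SphereZ p n K ≃ₜ Metric.sphere (0 : K) 1,
      ∀ x, (e x : K) = (x.1 : ℚ_[p]) • ((x.2.1 : K) * (x.2.2 : K)) := by
  have hn0 : n ≠ 0 := by rintro rfl; exact hn (dvd_zero p)
  have := compactSpace_sphereZ hn0 b
  let g : padicUnits p × SphereZ p n K → Metric.sphere (0 : K) 1 := fun x =>
    ⟨(x.1 : ℚ_[p]) • ((x.2.1 : K) * (x.2.2 : K)), by simpa using norm_smul_sphere hn0 b x⟩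
  have hg (x) : (g x : K) = algebraMap ℚ_[p] K x.1 * ((x.2.1 : K) * (x.2.2 : K)) :=
    Algebra.smul_def _ _
  have hcont : Continuous g := by
    refine Continuous.subtype_mk ?_ _
    fun_prop
  have hq1 : 1 ≤ p ^ n := Nat.one_le_pow _ _ (Fact.out : p.Prime).pos
  have hq : ¬ p ∣ p ^ n - 1 := fun h => (Fact.out : p.Prime).one_lt.ne'
    (Nat.dvd_one.1 ((Nat.dvd_sub_iff_right hq1 (dvd_pow_self p hn0)).1 h))
  have hbij : Function.Bijective g := by
    constructor
    · rintro ⟨r, ⟨ω, hω⟩, ⟨ξ, hξ'⟩⟩ ⟨r', ⟨ω', hω'⟩, ⟨ξ', hξ''⟩⟩ h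
      have h0 := congrArg Subtype.val h
      rw [hg, hg] at h0
      dsimp only at h0
      have hξ := (mem_sigmaSet_iff hn0 b).1 hξ'
      have hξ2 := (mem_sigmaSet_iff hn0 b).1 hξ''
      set t : K := algebraMap ℚ_[p] K r with ht
      set t' : K := algebraMap ℚ_[p] K r' with ht'
      have hrξ : ‖t * ξ - 1‖ < 1 :=
        (norm_mul_sub_one_le _ _ (norm_eq_one_of_norm_sub_one_lt hξ.1).le).trans_lt
          (max_lt (norm_algebraMap_padicUnits_sub_one r) hξ.1)
      have hrξ' : ‖t' * ξ' - 1‖ < 1 :=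
        (norm_mul_sub_one_le _ _ (norm_eq_one_of_norm_sub_one_lt hξ2.1).le).trans_lt
          (max_lt (norm_algebraMap_padicUnits_sub_one r') hξ2.1)
      have hω0 : ω ≠ 0 := norm_ne_zero_iff.1 (by
        rw [norm_eq_one_of_mem_muSet hn0 hω]; exact one_ne_zero)
      have hω0' : ω' ≠ 0 := norm_ne_zero_iff.1 (by
        rw [norm_eq_one_of_mem_muSet hn0 hω']; exact one_ne_zero)
      -- The quotient `ω' / ω` is a ratio of principal units and a root of unity of order prime to
      -- `p`, hence `1`. Taking norms then removes `ξ` and leaves `r ^ n = r' ^ n`.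
      have h1 : t * ξ ≠ 0 := norm_ne_zero_iff.1 (by
        rw [norm_eq_one_of_norm_sub_one_lt hrξ]; exact one_ne_zero)
      have h2 : ω' / ω = (t * ξ) * (t' * ξ')⁻¹ := by
        have h1' : t' * ξ' ≠ 0 := norm_ne_zero_iff.1 (by
          rw [norm_eq_one_of_norm_sub_one_lt hrξ']; exact one_ne_zero)
        rw [← div_eq_mul_inv, div_eq_div_iff hω0 h1']
        linear_combination -h0
      have h3 : ‖ω' / ω - 1‖ < 1 := by
        have h4 := norm_inv_sub_one hrξ'
        have h5 : ‖(t' * ξ')⁻¹ - 1‖ < 1 := h4.trans_lt hrξ'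
        rw [h2]
        exact (norm_mul_sub_one_le _ _ (norm_eq_one_of_norm_sub_one_lt h5).le).trans_lt
          (max_lt hrξ h5)
      have h4 : ω' / ω = 1 := by
        refine eq_one_of_pow_eq_one h3 (norm_natCast_extension_eq_one (p := p) hq) ?_
        rw [div_pow, show ω ^ (p ^ n - 1) = 1 from hω, show ω' ^ (p ^ n - 1) = 1 from hω', div_one]
      have h5 : ω' = ω := (div_eq_one_iff_eq hω0).1 h4
      subst h5
      have h6 : t * ξ = t' * ξ' := by
        refine mul_left_cancel₀ hω0 ?_
        linear_combination h0
      have h7 := congrArg (Algebra.norm ℚ_[p]) h6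
      rw [map_mul, map_mul, hξ.2, hξ2.2, mul_one, mul_one, ht, ht', Algebra.norm_algebraMap,
        Algebra.norm_algebraMap, Module.finrank_eq_card_basis b, Fintype.card_fin] at h7
      have h8 : r = r' := by
        rw [← div_eq_one]
        refine Subtype.ext (eq_one_of_pow_eq_one (r / r').2 (m := n) ?_ ?_)
        · exact Padic.norm_natCast_eq_one_iff.2 ((Fact.out : p.Prime).coprime_iff_not_dvd.2 hn)
        · have h9 : r ^ n = r' ^ n := Subtype.ext h7
          rw [← SubmonoidClass.coe_pow, div_pow, h9, div_self']
          rfl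
      subst h8
      have h9 : ξ = ξ' := by
        refine mul_left_cancel₀ (a := t) ?_ h6
        exact left_ne_zero_of_mul h1
      subst h9
      rfl
    · rintro ⟨x, hx⟩
      have hx1 : ‖x‖ = 1 := by simpa using hx
      obtain ⟨ω, hω, hxω⟩ := exists_root_of_unity hK b hx1
      have hω1 := norm_eq_one_of_mem_muSet hn0 (show ω ∈ muSet p n K from hω)
      have hω0 : ω ≠ 0 := norm_ne_zero_iff.1 (by rw [hω1]; exact one_ne_zero)
      have hu : ‖x / ω - 1‖ < 1 := by
        rw [div_sub_one hω0, norm_div, hω1, div_one]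
        exact hxω
      -- This choice of `r` makes the remaining factor `ξ = x / (ω r)` of norm `1`.
      obtain ⟨r, hr⟩ := exists_padicUnits_pow_eq hn ⟨_, norm_algebra_norm_sub_one_lt b hu⟩
      have hr' : (r : ℚ_[p]) ^ n = Algebra.norm ℚ_[p] (x / ω) := congrArg Subtype.val hr
      have hξ : ‖x / ω * (algebraMap ℚ_[p] K (r⁻¹ : padicUnits p)) - 1‖ < 1 := by
        have h1 := norm_algebraMap_padicUnits_sub_one (K := K) r⁻¹
        exact (norm_mul_sub_one_le _ _ (norm_eq_one_of_norm_sub_one_lt h1).le).trans_lt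
          (max_lt hu h1)
      have hN : Algebra.norm ℚ_[p] (x / ω * (algebraMap ℚ_[p] K (r⁻¹ : padicUnits p))) = 1 := by
        rw [map_mul, Algebra.norm_algebraMap, Module.finrank_eq_card_basis b, Fintype.card_fin,
          ← hr', padicUnits_coe_inv, inv_pow,
          mul_inv_cancel₀ (pow_ne_zero _ (padicUnits_ne_zero r))]
      refine ⟨⟨r, ⟨ω, hω⟩, ⟨_, (mem_sigmaSet_iff hn0 b).2 ⟨hξ, hN⟩⟩⟩, Subtype.ext ?_⟩
      rw [hg]
      dsimp only
      rw [padicUnits_coe_inv, map_inv₀]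
      have hr0 : algebraMap ℚ_[p] K r ≠ 0 := by
        simpa using padicUnits_ne_zero r
      field_simp
  exact ⟨hcont.homeoOfEquivCompactToT2 (f := Equiv.ofBijective g hbij), fun x => rfl⟩

end Sphere

/-! ### Equivariant functionals on `S × Z` -/

section Equivariant

variable {p : ℕ} [Fact p.Prime] {Z : Type*} [TopologicalSpace Z] [CompactSpace Z]

/-- Local constancy is uniform in the second variable, so whole slices agree for nearby `r`. Hence
any linear functional of the slice is locally constant in `r`, without continuity assumptions on it.
-/
theorem isLocallyConstant_sliceFst (g : LocallyConstant (padicUnits p × Z) ℂ) :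
    IsLocallyConstant (sliceFst g) := by
  obtain ⟨H, hH, hg⟩ := exists_isOpen_subgroup_invariant g
  rw [IsLocallyConstant.iff_eventually_eq]
  intro r
  have h2 : Filter.Tendsto (fun t : padicUnits p => t * r⁻¹) (nhds r) (nhds 1) := by
    have : Continuous (fun t : padicUnits p => t * r⁻¹) := by fun_prop
    simpa using this.tendsto r
  filter_upwards [h2.eventually (hH.mem_nhds H.one_mem)] with t ht
  ext η
  have := hg _ ht r η
  rwa [inv_mul_cancel_right] at this

theorem integrable_of_isLocallyConstant {E : Type*} [NormedAddCommGroup E]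
    {h : padicUnits p → E} (hh : IsLocallyConstant h) :
    Integrable h (padicUnitsHaar p) := by
  rw [← integrableOn_univ]
  exact hh.continuous.continuousOn.integrableOn_compact isCompact_univ

/-- A functional that transforms under translations by the character `θ⁻¹` is given by integration
against `θ`. -/
theorem equivariant_functional_eq_integral (χ : LocallyConstant (padicUnits p) ℂ)
    (hχ : ∀ t r, χ (t * r) = χ t * χ r) (hχ0 : ∀ t, χ t ≠ 0)
    (L : LocallyConstant (padicUnits p × Z) ℂ →ₗ[ℂ] ℂ)
    (hL : ∀ t g, L (g.comap (translateFst Z t)) = (χ t)⁻¹ * L g) {C : ℂ} (hC : C ≠ 0) :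
    ∃ F : Module.Dual ℂ (LocallyConstant Z ℂ), ∀ g,
      L g = C * ∫ r, F (sliceFst g r) * χ r ∂(padicUnitsHaar p) := by
  let X : LocallyConstant (padicUnits p × Z) ℂ := χ.comap ⟨Prod.fst, continuous_fst⟩
  have hX (x) : X x = χ x.1 := rfl
  set V : ℂ := Complex.ofReal ((padicUnitsHaar p).real Set.univ)
  have hV : V ≠ 0 := Complex.ofReal_ne_zero.2 padicUnitsHaar_real_univ_ne_zero
  -- Twisting by `χ⁻¹` cancels the character and makes the functional invariant.
  let L' : LocallyConstant (padicUnits p × Z) ℂ →ₗ[ℂ] ℂ := L ∘ₗ LinearMap.mulLeft ℂ X⁻¹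
  have hL'_apply (g) : L' g = L (X⁻¹ * g) := rfl
  have hL' (t g) : L' (g.comap (translateFst Z t)) = L' g := by
    have h1 : X⁻¹ * g.comap (translateFst Z t)
        = (χ t • (X⁻¹ * g)).comap (translateFst Z t) := by
      ext x
      change (χ x.1)⁻¹ * g (t * x.1, x.2) = χ t * ((χ (t * x.1))⁻¹ * g (t * x.1, x.2))
      rw [hχ, mul_inv, mul_assoc, mul_inv_cancel_left₀ (hχ0 t)]
    rw [hL'_apply, h1, hL, map_smul, smul_eq_mul, inv_mul_cancel_left₀ (hχ0 t), hL'_apply]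
  -- `F` is the twisted functional on functions constant along the group. The volume `V` comes from
  -- averaging; `C` is the prescribed constant in front of the integral.
  refine ⟨(C * V)⁻¹ • (L' ∘ₗ LocallyConstant.comapₗ ℂ ⟨Prod.snd, continuous_snd⟩), fun g => ?_⟩
  have h1 := invariant_functional_eq_integral (padicUnitsHaar p) L' hL' (X * g)
  have h2 : X⁻¹ * (X * g) = g := by
    ext x
    exact inv_mul_cancel_left₀ (hχ0 x.1) _
  rw [hL'_apply, h2] at h1
  have h3 (r : padicUnits p) : L' (constFst (padicUnits p) (sliceFst (X * g) r))
      = C * V * (((C * V)⁻¹ • (L' ∘ₗ LocallyConstant.comapₗ ℂ ⟨Prod.snd, continuous_snd⟩))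
          (sliceFst g r) * χ r) := by
    have h4 : constFst (padicUnits p) (sliceFst (X * g) r)
        = χ r • constFst (padicUnits p) (sliceFst g r) := by
      ext x
      rfl
    rw [h4, map_smul, smul_eq_mul, LinearMap.smul_apply, smul_eq_mul, mul_assoc (C * V)⁻¹,
      mul_inv_cancel_left₀ (mul_ne_zero hC hV), mul_comm]
    rfl
  simp_rw [h3] at h1
  rw [integral_const_mul, mul_assoc, mul_left_comm] at h1
  exact mul_left_cancel₀ hV h1

end Equivariant

/-! ### Test functions on `K` and their restrictions to the shells -/

section TestFunctions

variable {p : ℕ} [Fact p.Prime] {n : ℕ} {K : Type*} [NormedField K] [NormedAlgebra ℚ_[p] K]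
  [IsUltrametricDist K] [ProperSpace K]

/-- The dilation `φ ↦ φ(t⁻¹ ·)`. -/
noncomputable def dilate (K : Type*) [NormedField K] [NormedAlgebra ℚ_[p] K] (t : ℚ_[p])
    (ht : t ≠ 0) : BSTestFunction K →ₗ[ℂ] BSTestFunction K :=
  BSTestFunction.comp (Homeomorph.smulOfNeZero t⁻¹ (inv_ne_zero ht))

omit [IsUltrametricDist K] [ProperSpace K] in
theorem dilate_apply {t : ℚ_[p]} (ht : t ≠ 0) (φ : BSTestFunction K) (x : K) :
    (dilate K t ht φ).1 x = φ.1 (t⁻¹ • x) := rfl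

omit [ProperSpace K] in
theorem isOpen_unit_sphere : IsOpen (Metric.sphere (0 : K) 1) :=
  IsUltrametricDist.isOpen_sphere 0 one_ne_zero

open Classical in
/-- Extension by zero of a function on the units of `K`. -/
noncomputable def extendSphereFun {X : Type*} [TopologicalSpace X]
    (e : X ≃ₜ Metric.sphere (0 : K) 1) (g : X → ℂ) (x : K) : ℂ :=
  if h : x ∈ Metric.sphere (0 : K) 1 then g (e.symm ⟨x, h⟩) else 0

omit [IsUltrametricDist K] [ProperSpace K] in
theorem extendSphereFun_of_mem {X : Type*} [TopologicalSpace X]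
    (e : X ≃ₜ Metric.sphere (0 : K) 1) (g : X → ℂ) {x : K} (hx : x ∈ Metric.sphere (0 : K) 1) :
    extendSphereFun e g x = g (e.symm ⟨x, hx⟩) :=
  dif_pos hx

omit [IsUltrametricDist K] [ProperSpace K] in
theorem extendSphereFun_of_notMem {X : Type*} [TopologicalSpace X]
    (e : X ≃ₜ Metric.sphere (0 : K) 1) (g : X → ℂ) {x : K} (hx : x ∉ Metric.sphere (0 : K) 1) :
    extendSphereFun e g x = 0 :=
  dif_neg hx

/-- Extension by zero of a locally constant function on the units of `K`, as a test function. -/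
noncomputable def extendSphere {X : Type*} [TopologicalSpace X] (e : X ≃ₜ Metric.sphere (0 : K) 1) :
    LocallyConstant X ℂ →ₗ[ℂ] BSTestFunction K where
  toFun g := ⟨⟨extendSphereFun e g, by
    rw [IsLocallyConstant.iff_eventually_eq]
    intro x
    by_cases hx : x ∈ Metric.sphere (0 : K) 1
    · have h1 := (g.isLocallyConstant.comp_continuous e.symm.continuous).eventually_eq ⟨x, hx⟩
      rw [← isOpen_unit_sphere.isOpenEmbedding_subtypeVal.map_nhds_eq ⟨x, hx⟩, Filter.eventually_map]
      filter_upwards [h1] with y hy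
      rw [extendSphereFun_of_mem e g y.2, extendSphereFun_of_mem e g hx]
      exact hy
    · filter_upwards [Metric.isClosed_sphere.isOpen_compl.mem_nhds hx] with y hy
      rw [extendSphereFun_of_notMem e g hy, extendSphereFun_of_notMem e g hx]⟩, by
    refine HasCompactSupport.of_support_subset_isCompact (isCompact_sphere (0 : K) 1) fun x hx => ?_
    by_contra h
    exact hx (extendSphereFun_of_notMem e g h)⟩
  map_add' g h := by
    refine Subtype.ext (LocallyConstant.ext fun x => ?_)
    change extendSphereFun e (g + h) x = extendSphereFun e g x + extendSphereFun e h x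
    by_cases hx : x ∈ Metric.sphere (0 : K) 1
    · simp only [extendSphereFun_of_mem e _ hx, Pi.add_apply]
    · simp only [extendSphereFun_of_notMem e _ hx, add_zero]
  map_smul' c g := by
    refine Subtype.ext (LocallyConstant.ext fun x => ?_)
    change extendSphereFun e (c • ⇑g) x = c • extendSphereFun e g x
    by_cases hx : x ∈ Metric.sphere (0 : K) 1
    · simp only [extendSphereFun_of_mem e _ hx, Pi.smul_apply]
    · simp only [extendSphereFun_of_notMem e _ hx, smul_zero]

theorem extendSphere_apply {X : Type*} [TopologicalSpace X] (e : X ≃ₜ Metric.sphere (0 : K) 1)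
    (g : LocallyConstant X ℂ) (y : X) : (extendSphere e g).1 (e y) = g y := by
  refine (extendSphereFun_of_mem e g (e y).2).trans ?_
  simp

theorem extendSphere_apply_of_norm_ne {X : Type*} [TopologicalSpace X]
    (e : X ≃ₜ Metric.sphere (0 : K) 1) (g : LocallyConstant X ℂ) {x : K} (hx : ‖x‖ ≠ 1) :
    (extendSphere e g).1 x = 0 :=
  extendSphereFun_of_notMem e g (by simpa using hx)

/-- The function `(r, η) ↦ φ(p ^ ν r η)`. -/
noncomputable def shellPullback (p n : ℕ) [Fact p.Prime] {K : Type*} [NormedField K]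
    [NormedAlgebra ℚ_[p] K] (φ : BSTestFunction K) (ν : ℤ) :
    LocallyConstant (padicUnits p × SphereZ p n K) ℂ :=
  φ.1.comap ⟨fun x => (p : ℚ_[p]) ^ ν • (x.1 : ℚ_[p]) • ((x.2.1 : K) * (x.2.2 : K)), by fun_prop⟩

omit [IsUltrametricDist K] [ProperSpace K] in
theorem sliceFst_shellPullback (φ : BSTestFunction K) (ν : ℤ) (r : padicUnits p) :
    sliceFst (shellPullback p n φ ν) r = sphereRestrict φ ((p : ℚ_[p]) ^ ν * (r : ℚ_[p])) := by
  ext η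
  exact congrArg φ.1 (smul_smul _ _ _)

variable (K) in
/-- The indicator function of the ring of integers. -/
noncomputable def unitBallFunction : BSTestFunction K :=
  ⟨LocallyConstant.charFn ℂ (IsUltrametricDist.isClopen_closedBall (0 : K) one_ne_zero), by
    refine HasCompactSupport.of_support_subset_isCompact (isCompact_closedBall (0 : K) 1)
      fun x hx => ?_
    rw [LocallyConstant.coe_charFn] at hx
    exact Set.mem_of_indicator_ne_zero hx⟩

theorem unitBallFunction_apply (x : K) :
    (unitBallFunction K).1 x = if ‖x‖ ≤ 1 then 1 else 0 := by
  change LocallyConstant.charFn ℂ (IsUltrametricDist.isClopen_closedBall (0 : K) one_ne_zero) x = _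
  classical
  rw [LocallyConstant.coe_charFn, Set.indicator_apply]
  simp

variable {e : padicUnits p × SphereZ p n K ≃ₜ Metric.sphere (0 : K) 1}
  (he : ∀ x, (e x : K) = (x.1 : ℚ_[p]) • ((x.2.1 : K) * (x.2.2 : K)))

include he in
theorem extendSphere_shellPullback (φ : BSTestFunction K) (ν : ℤ) (x : K) :
    (extendSphere e (shellPullback p n φ ν)).1 x
      = if ‖x‖ = 1 then φ.1 ((p : ℚ_[p]) ^ ν • x) else 0 := by
  split_ifs with hx
  · obtain ⟨y, hy⟩ := e.surjective ⟨x, by simpa using hx⟩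
    have hy' : (e y : K) = x := congrArg Subtype.val hy
    rw [← hy', extendSphere_apply, he]
    rfl
  · exact extendSphere_apply_of_norm_ne e _ hx

include he in
-- Translation evaluates at `t x`, whereas `dilate` by `t` evaluates at `t⁻¹ x`. This is the source
-- of the inverse character in the transformation law.
theorem extendSphere_translate (t : padicUnits p)
    (g : LocallyConstant (padicUnits p × SphereZ p n K) ℂ) :
    extendSphere e (g.comap (translateFst _ t))
      = dilate K ((t⁻¹ : padicUnits p) : ℚ_[p]) (padicUnits_ne_zero _) (extendSphere e g) := by
  refine Subtype.ext (LocallyConstant.ext fun x => ?_)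
  rw [dilate_apply, padicUnits_coe_inv, inv_inv]
  by_cases hx : ‖x‖ = 1
  · obtain ⟨y, hy⟩ := e.surjective ⟨x, by simpa using hx⟩
    have hy' : (e y : K) = x := congrArg Subtype.val hy
    have h1 : (t : ℚ_[p]) • x = e (t * y.1, y.2) := by
      rw [← hy', he, he, smul_smul]
      rfl
    rw [h1, ← hy', extendSphere_apply, extendSphere_apply]
    rfl
  · rw [extendSphere_apply_of_norm_ne e _ hx, extendSphere_apply_of_norm_ne e _]
    rwa [norm_smul, padicUnits_norm, one_mul]

theorem norm_padic_zpow_le_iff {a b : ℤ} :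
    ‖(p : ℚ_[p]) ^ a‖ ≤ ‖(p : ℚ_[p]) ^ b‖ ↔ b ≤ a := by
  have h1 : (1 : ℝ) < p := by exact_mod_cast (Fact.out : p.Prime).one_lt
  rw [Padic.norm_p_zpow, Padic.norm_p_zpow, zpow_le_zpow_iff_right₀ h1, neg_le_neg_iff]

omit [NormedAlgebra ℚ_[p] K] [IsUltrametricDist K] [ProperSpace K] in
theorem exists_shell_bound (φ : BSTestFunction K) : ∃ M : ℕ,
    (∀ x : K, ‖x‖ ≤ ‖(p : ℚ_[p]) ^ (M : ℤ)‖ → φ.1 x = φ.1 0) ∧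
    ∀ x : K, φ.1 x ≠ 0 → ‖x‖ ≤ ‖(p : ℚ_[p]) ^ (-(M : ℤ))‖ := by
  obtain ⟨ε, hε, h1⟩ := Metric.eventually_nhds_iff.1 (φ.1.isLocallyConstant.eventually_eq 0)
  obtain ⟨R, hR⟩ := φ.2.isCompact.isBounded.exists_norm_le
  have hp1 : (1 : ℝ) < p := by exact_mod_cast (Fact.out : p.Prime).one_lt
  obtain ⟨M₁, hM₁⟩ := pow_unbounded_of_one_lt R hp1
  obtain ⟨M₂, hM₂⟩ := pow_unbounded_of_one_lt ε⁻¹ hp1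
  refine ⟨max M₁ M₂, fun x hx => h1 ?_, fun x hx => ?_⟩
  · rw [dist_zero_right]
    refine hx.trans_lt ?_
    rw [Padic.norm_p_zpow, zpow_neg, zpow_natCast]
    exact inv_lt_of_inv_lt₀ hε (hM₂.trans_le (pow_le_pow_right₀ hp1.le (le_max_right _ _)))
  · rw [Padic.norm_p_zpow, neg_neg, zpow_natCast]
    exact (hR x (subset_tsupport _ hx)).trans
      (hM₁.le.trans (pow_le_pow_right₀ hp1.le (le_max_left _ _)))

include he in
theorem dilate_extendSphere_shellPullback (φ : BSTestFunction K) (ν : ℤ) (x : K) :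
    (dilate K ((p : ℚ_[p]) ^ ν) (zpow_ne_zero ν padic_p_ne_zero)
      (extendSphere e (shellPullback p n φ ν))).1 x
      = if ‖x‖ = ‖(p : ℚ_[p]) ^ ν‖ then φ.1 x else 0 := by
  have h0 : (p : ℚ_[p]) ^ ν ≠ 0 := zpow_ne_zero ν padic_p_ne_zero
  rw [dilate_apply, extendSphere_shellPullback he, smul_inv_smul₀ h0]
  refine if_congr ?_ rfl rfl
  rw [norm_smul, norm_inv, inv_mul_eq_one₀ (norm_ne_zero_iff.2 h0), eq_comm]

theorem dilate_unitBallFunction {t : ℚ_[p]} (ht : t ≠ 0) (x : K) :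
    (dilate K t ht (unitBallFunction K)).1 x = if ‖x‖ ≤ ‖t‖ then 1 else 0 := by
  rw [dilate_apply, unitBallFunction_apply]
  refine if_congr ?_ rfl rfl
  rw [norm_smul, norm_inv, inv_mul_le_iff₀ (norm_pos_iff.2 ht), mul_one]

theorem dilate_padicUnits_unitBallFunction (t : padicUnits p) :
    dilate K (t : ℚ_[p]) (padicUnits_ne_zero t) (unitBallFunction K) = unitBallFunction K := by
  refine Subtype.ext (LocallyConstant.ext fun x => ?_)
  rw [dilate_unitBallFunction, unitBallFunction_apply, padicUnits_norm]

variable (hval : ∀ x : K, x ≠ 0 → ∃ ν : ℤ, ‖x‖ = ‖(p : ℚ_[p]) ^ ν‖)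

include he hval in
-- By `hval` each nonzero `x` lies on one shell. Those with `-M ≤ ν < M` are indexed by `ν = k - M`;
-- beyond them `φ` is zero on the outside and equal to `φ 0` on the inside.
theorem testFunction_eq_sum_shells (φ : BSTestFunction K) {M : ℕ}
    (hM : ∀ x : K, ‖x‖ ≤ ‖(p : ℚ_[p]) ^ (M : ℤ)‖ → φ.1 x = φ.1 0)
    (hM' : ∀ x : K, φ.1 x ≠ 0 → ‖x‖ ≤ ‖(p : ℚ_[p]) ^ (-(M : ℤ))‖) :
    φ = (∑ k ∈ Finset.range (2 * M),
          dilate K ((p : ℚ_[p]) ^ ((k : ℤ) - M)) (zpow_ne_zero _ padic_p_ne_zero)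
            (extendSphere e (shellPullback p n φ ((k : ℤ) - M))))
        + φ.1 0 • dilate K ((p : ℚ_[p]) ^ (M : ℤ)) (zpow_ne_zero _ padic_p_ne_zero)
            (unitBallFunction K) := by
  refine Subtype.ext (LocallyConstant.ext fun x => ?_)
  let ev : BSTestFunction K →ₗ[ℂ] ℂ := LocallyConstant.evalₗ ℂ x ∘ₗ (BSTestFunction K).subtype
  have hev (ψ : BSTestFunction K) : ψ.1 x = ev ψ := rfl
  rw [hev, hev (_ + _), map_add, map_sum, map_smul]
  change φ.1 x = ∑ k ∈ Finset.range (2 * M), (dilate K ((p : ℚ_[p]) ^ ((k : ℤ) - M))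
    (zpow_ne_zero _ padic_p_ne_zero) (extendSphere e (shellPullback p n φ ((k : ℤ) - M)))).1 x 
    + φ.1 0 • (dilate K ((p : ℚ_[p]) ^ (M : ℤ)) (zpow_ne_zero _ padic_p_ne_zero)
      (unitBallFunction K)).1 x
  simp_rw [dilate_extendSphere_shellPullback he, dilate_unitBallFunction]
  by_cases h1 : ‖x‖ ≤ ‖(p : ℚ_[p]) ^ (M : ℤ)‖
  · rw [Finset.sum_eq_zero, if_pos h1, zero_add, smul_eq_mul, mul_one, hM x h1]
    intro k hk
    rw [Finset.mem_range] at hk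
    refine if_neg fun h2 => ?_
    rw [h2, norm_padic_zpow_le_iff] at h1
    omega
  · rw [if_neg h1, smul_zero, add_zero]
    by_cases h2 : φ.1 x = 0
    · simp [h2]
    have hx0 : x ≠ 0 := by rintro rfl; simp at h1
    obtain ⟨ν, hν⟩ := hval x hx0
    have h3 := hM' x h2
    rw [hν, norm_padic_zpow_le_iff] at h1 h3
    rw [Finset.sum_eq_single (ν + M).toNat]
    · rw [if_pos]
      rw [hν]
      congr 2
      omega
    · intro k _ hk
      refine if_neg fun h4 => hk ?_
      have h5 : ν = (k : ℤ) - M := norm_padic_zpow_injective (p := p) (hν.symm.trans h4)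
      omega
    · intro h4
      rw [Finset.mem_range] at h4
      omega

include hval in
-- The disjoint union `O = O^× ⊔ pO`. A homogeneous functional applied to it yields an equation for
-- its value on the indicator of `O`.
theorem unitBallFunction_eq_add :
    unitBallFunction K = extendSphere e 1
      + dilate K ((p : ℚ_[p]) ^ (1 : ℤ)) (zpow_ne_zero _ padic_p_ne_zero) (unitBallFunction K) := by
  refine Subtype.ext (LocallyConstant.ext fun x => ?_)
  change _ = (extendSphere e 1).1 x + (dilate K _ _ (unitBallFunction K)).1 x
  rw [dilate_unitBallFunction, unitBallFunction_apply]
  by_cases hx : ‖x‖ = 1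
  · obtain ⟨y, hy⟩ := e.surjective ⟨x, by simpa using hx⟩
    have hy' : (e y : K) = x := congrArg Subtype.val hy
    have h1 : (extendSphere e 1).1 x = 1 := by rw [← hy', extendSphere_apply]; rfl
    rw [h1, if_pos hx.le, if_neg, add_zero]
    have h2 : (1 : ℝ) = ‖(p : ℚ_[p]) ^ (0 : ℤ)‖ := by simp
    rw [hx, h2, norm_padic_zpow_le_iff]
    norm_num
  · rw [extendSphere_apply_of_norm_ne e _ hx, zero_add]
    by_cases hx0 : x = 0
    · simp [hx0]
    obtain ⟨ν, hν⟩ := hval x hx0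
    have h2 : (1 : ℝ) = ‖(p : ℚ_[p]) ^ (0 : ℤ)‖ := by simp
    have h3 : ν ≠ 0 := by rintro rfl; exact hx (by rw [hν, ← h2])
    have h4 : ‖x‖ ≤ 1 ↔ ‖x‖ ≤ ‖(p : ℚ_[p]) ^ (1 : ℤ)‖ := by
      rw [hν, h2, norm_padic_zpow_le_iff, norm_padic_zpow_le_iff]
      omega
    simp only [h4]

end TestFunctions

/-! ### Radial weights -/

section Weights

variable {p : ℕ} [Fact p.Prime]

theorem ofReal_zpow_cpow {x : ℝ} (hx : 0 < x) (ν : ℤ) (z : ℂ) :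
    ((x ^ ν : ℝ) : ℂ) ^ z = ((x : ℂ) ^ z) ^ ν := by
  have h1 : ((x ^ ν : ℝ) : ℂ) ≠ 0 := Complex.ofReal_ne_zero.2 (zpow_pos hx ν).ne'
  rw [Complex.cpow_def_of_ne_zero h1, Complex.cpow_def_of_ne_zero (Complex.ofReal_ne_zero.2 hx.ne'),
    ← Complex.ofReal_log (zpow_pos hx ν).le, ← Complex.ofReal_log hx.le, Real.log_zpow,
    ← Complex.exp_int_mul]
  push_cast
  ring_nf

theorem norm_padic_p_pos : 0 < ‖(p : ℚ_[p])‖ := norm_pos_iff.2 padic_p_ne_zero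

/-- The factor `|p| ^ (z + n)` by which dilation by `p` scales. -/
noncomputable def radialWeight (p : ℕ) [Fact p.Prime] (n : ℕ) (z : ℂ) : ℂ :=
  (‖(p : ℚ_[p])‖ : ℂ) ^ (z + n)

theorem radialWeight_ne_zero (n : ℕ) (z : ℂ) : radialWeight p n z ≠ 0 := by
  rw [radialWeight, Ne, Complex.cpow_eq_zero_iff]
  exact fun h => (Complex.ofReal_ne_zero.2 norm_padic_p_pos.ne') h.1

theorem norm_radialWeight_lt_one {n : ℕ} {z : ℂ} (hz : -(n : ℝ) < z.re) :
    ‖radialWeight p n z‖ < 1 := by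
  rw [radialWeight, Complex.norm_cpow_eq_rpow_re_of_pos norm_padic_p_pos]
  refine Real.rpow_lt_one (norm_nonneg _) Padic.norm_p_lt_one ?_
  simp only [Complex.add_re, Complex.natCast_re]
  linarith

theorem analyticAt_radialWeight (n : ℕ) (z : ℂ) : AnalyticAt ℂ (radialWeight p n) z := by
  refine Differentiable.analyticAt ?_ z
  exact (differentiable_id.add_const _).const_cpow
    (Or.inl (Complex.ofReal_ne_zero.2 norm_padic_p_pos.ne'))

/-- The first factor is the Jacobian of `r ↦ p ^ ν r`; it absorbs the `-1` in the exponent of the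
radial integrand. -/
theorem norm_mul_cpow_eq_radialWeight (n : ℕ) (z : ℂ) (ν : ℤ) :
    (‖(p : ℚ_[p]) ^ ν‖ : ℂ) * (‖(p : ℚ_[p]) ^ ν‖ : ℂ) ^ (z + n - 1) = radialWeight p n z ^ ν := by
  have h0 : (‖(p : ℚ_[p]) ^ ν‖ : ℂ) ≠ 0 :=
    Complex.ofReal_ne_zero.2 (norm_ne_zero_iff.2 (zpow_ne_zero ν padic_p_ne_zero))
  rw [Complex.cpow_sub _ _ h0, Complex.cpow_one, mul_div_cancel₀ _ h0, norm_zpow,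
    ofReal_zpow_cpow norm_padic_p_pos]
  rfl

theorem quasichar_zpow_mul {n : ℕ} {θ : ℚ_[p] →*₀ ℂ} (hθp : θ (p : ℚ_[p]) = 1) (s : ℂ) (ν : ℤ) :
    quasichar s θ ((p : ℚ_[p]) ^ ν) * (‖(p : ℚ_[p]) ^ ν‖ : ℂ) ^ n = radialWeight p n s ^ ν := by
  have h0 : (‖(p : ℚ_[p]) ^ ν‖ : ℂ) ≠ 0 :=
    Complex.ofReal_ne_zero.2 (norm_ne_zero_iff.2 (zpow_ne_zero ν padic_p_ne_zero))
  rw [quasichar, map_zpow₀, hθp, one_zpow, mul_one, ← Complex.cpow_natCast, ← Complex.cpow_add _ _ h0,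
    norm_zpow, ofReal_zpow_cpow norm_padic_p_pos]
  rfl

/-- Used contrapositively: non-exceptionality leaves either a weight different from `1` or a
character nontrivial on principal units. -/
theorem isExceptional_of_trivial {n : ℕ} {θ : ℚ_[p] →*₀ ℂ} (hθp : θ (p : ℚ_[p]) = 1)
    (hθ : ∀ r : padicUnits p, θ (r : ℚ_[p]) = 1) {z : ℂ} (hz : radialWeight p n z = 1) :
    IsExceptional n z θ := by
  rintro _ ⟨ν, u, hu, rfl⟩
  have h0 : (‖(p : ℚ_[p]) ^ ν‖ : ℂ) ≠ 0 :=
    Complex.ofReal_ne_zero.2 (norm_ne_zero_iff.2 (zpow_ne_zero ν padic_p_ne_zero))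
  have h1 := quasichar_zpow_mul (n := n) hθp z ν
  have h2 : quasichar z θ ((p : ℚ_[p]) ^ ν * u) = quasichar z θ ((p : ℚ_[p]) ^ ν) := by
    rw [quasichar, quasichar, norm_mul, norm_eq_one_of_norm_sub_one_lt hu, mul_one, map_mul,
      hθ ⟨u, hu⟩, mul_one]
  rw [hz, one_zpow] at h1
  rw [h2, norm_mul, norm_eq_one_of_norm_sub_one_lt hu, mul_one, Complex.cpow_neg,
    Complex.cpow_natCast]
  exact eq_inv_of_mul_eq_one_left h1

/-- A two-sided series that is zero far to the left and geometric from `M` on. It serves over `ℂ`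
for the integral and over `ℝ` for the integral of the norm. -/
theorem hasSum_shells {𝕜 : Type*} [NormedField 𝕜] [CompleteSpace 𝕜] {x B : 𝕜} (hx0 : x ≠ 0)
    (hx : ‖x‖ < 1) {a : ℤ → 𝕜} {M : ℕ} (h0 : ∀ ν : ℤ, ν < -M → a ν = 0)
    (h1 : ∀ ν : ℤ, M ≤ ν → a ν = x ^ ν * B) :
    HasSum a ((∑ k ∈ Finset.range (2 * M), a ((k : ℤ) - M)) + x ^ (M : ℤ) * B / (1 - x)) := by
  have hinj : Function.Injective fun k : ℕ => (k : ℤ) - M := fun a b h => by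
    simpa using h
  rw [← hinj.hasSum_iff, add_comm]
  · refine (hasSum_nat_add_iff (f := a ∘ fun k : ℕ => (k : ℤ) - M) (2 * M)).1 ?_
    have h2 : (fun k : ℕ => (a ∘ fun k : ℕ => (k : ℤ) - M) (k + 2 * M))
        = fun k => x ^ (M : ℤ) * B * x ^ k := by
      ext k
      change a (((k + 2 * M : ℕ) : ℤ) - M) = _
      rw [h1 _ (by push_cast; omega)]
      have h3 : ((k + 2 * M : ℕ) : ℤ) - M = M + k := by push_cast; ring
      rw [h3, zpow_add₀ hx0, zpow_natCast x k]
      ring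
    rw [h2, div_eq_mul_inv]
    exact (hasSum_geometric_of_norm_lt_one hx).mul_left _
  · intro ν hν
    refine h0 ν (not_le.1 fun h => hν ⟨(ν + M).toNat, ?_⟩)
    change ((ν + M).toNat : ℤ) - M = ν
    omega

end Weights

/-! ### The radial integral -/

section RadialIntegral

open scoped Pointwise

variable {p : ℕ} [Fact p.Prime] {n : ℕ} {K : Type*} [NormedField K] [NormedAlgebra ℚ_[p] K]

/-- The integral of `⟨F, φ(p ^ ν r ·)⟩ θ(r)` over the principal units. -/
noncomputable def shellIntegral (F : SphereDistribution p n K) (θ : ℚ_[p] →*₀ ℂ)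
    (φ : BSTestFunction K) (ν : ℤ) : ℂ :=
  ∫ r : padicUnits p, F (sliceFst (shellPullback p n φ ν) r) * θ (r : ℚ_[p]) ∂(padicUnitsHaar p)

theorem radialIntegrand_shell (F : SphereDistribution p n K) {θ : ℚ_[p] →*₀ ℂ}
    (hθp : θ (p : ℚ_[p]) = 1) (φ : BSTestFunction K) (z : ℂ) (ν : ℤ) (r : padicUnits p) :
    radialIntegrand F θ φ z ((p : ℚ_[p]) ^ ν * (r : ℚ_[p]))
      = (‖(p : ℚ_[p]) ^ ν‖ : ℂ) ^ (z + n - 1) *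
        (F (sliceFst (shellPullback p n φ ν) r) * θ (r : ℚ_[p])) := by
  rw [radialIntegrand, ← sliceFst_shellPullback, norm_mul, padicUnits_norm, mul_one, map_mul,
    map_zpow₀, hθp, one_zpow, one_mul]
  ring

theorem isLocallyConstant_shell [CompactSpace (SphereZ p n K)] (F : SphereDistribution p n K)
    {θ : ℚ_[p] →*₀ ℂ}
    (hθ : ContinuousOn θ {0}ᶜ) (φ : BSTestFunction K) (ν : ℤ) :
    IsLocallyConstant fun r : padicUnits p =>
      F (sliceFst (shellPullback p n φ ν) r) * θ (r : ℚ_[p]) :=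
  ((isLocallyConstant_sliceFst (shellPullback p n φ ν)).comp F).mul
    (isLocallyConstant_character θ hθ)

theorem integrableOn_shell [CompactSpace (SphereZ p n K)] (F : SphereDistribution p n K)
    {θ : ℚ_[p] →*₀ ℂ}
    (hθ : ContinuousOn θ {0}ᶜ) (hθp : θ (p : ℚ_[p]) = 1) (φ : BSTestFunction K) (z : ℂ) (ν : ℤ) :
    IntegrableOn (radialIntegrand F θ φ z) ((p : ℚ_[p]) ^ ν • (padicUnits p : Set ℚ_[p]))
      (padicHaar p) := by
  refine integrableOn_padicHaar_smul (zpow_ne_zero ν padic_p_ne_zero) _ _ ?_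
  have h1 := (integrable_of_isLocallyConstant (isLocallyConstant_shell F hθ φ ν)).const_mul
    ((‖(p : ℚ_[p]) ^ ν‖ : ℂ) ^ (z + n - 1))
  simp_rw [← radialIntegrand_shell F hθp φ z ν] at h1
  have h2 := (measurableEmbedding_padicUnits_coe (p := p)).integrableOn_range_iff_comap
    (f := fun r => radialIntegrand F θ φ z ((p : ℚ_[p]) ^ ν * r)) (μ := padicHaar p)
  rw [Subtype.range_coe] at h2
  exact h2.2 h1

theorem integral_shell (F : SphereDistribution p n K) {θ : ℚ_[p] →*₀ ℂ}
    (hθp : θ (p : ℚ_[p]) = 1) (φ : BSTestFunction K) (z : ℂ) (ν : ℤ) :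
    ∫ r in (p : ℚ_[p]) ^ ν • (padicUnits p : Set ℚ_[p]), radialIntegrand F θ φ z r ∂(padicHaar p)
      = radialWeight p n z ^ ν * shellIntegral F θ φ ν := by
  rw [setIntegral_padicHaar_smul (zpow_ne_zero ν padic_p_ne_zero), ← integral_padicUnitsHaar,
    Complex.real_smul, ← norm_mul_cpow_eq_radialWeight, mul_assoc, shellIntegral]
  simp_rw [radialIntegrand_shell F hθp, integral_const_mul]

theorem integral_norm_shell (F : SphereDistribution p n K) {θ : ℚ_[p] →*₀ ℂ}
    (hθp : θ (p : ℚ_[p]) = 1) (φ : BSTestFunction K) (z : ℂ) (ν : ℤ) :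
    ∫ r in (p : ℚ_[p]) ^ ν • (padicUnits p : Set ℚ_[p]),
        ‖radialIntegrand F θ φ z r‖ ∂(padicHaar p)
      = ‖radialWeight p n z‖ ^ ν * ∫ r : padicUnits p,
        ‖F (sliceFst (shellPullback p n φ ν) r) * θ (r : ℚ_[p])‖ ∂(padicUnitsHaar p) := by
  rw [setIntegral_padicHaar_smul (zpow_ne_zero ν padic_p_ne_zero),
    ← integral_padicUnitsHaar fun r => ‖radialIntegrand F θ φ z ((p : ℚ_[p]) ^ ν * r)‖,
    smul_eq_mul, ← norm_zpow, ← norm_mul_cpow_eq_radialWeight, norm_mul, Complex.norm_real,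
    norm_norm, mul_assoc]
  simp_rw [radialIntegrand_shell F hθp, norm_mul, integral_const_mul]

variable {φ : BSTestFunction K} {M : ℕ}
  (hM : ∀ x : K, ‖x‖ ≤ ‖(p : ℚ_[p]) ^ (M : ℤ)‖ → φ.1 x = φ.1 0)
  (hM' : ∀ x : K, φ.1 x ≠ 0 → ‖x‖ ≤ ‖(p : ℚ_[p]) ^ (-(M : ℤ))‖)
  (hnorm : ∀ x : padicUnits p × SphereZ p n K,
    ‖(x.1 : ℚ_[p]) • ((x.2.1 : K) * (x.2.2 : K))‖ = 1)

include hM hnorm in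
theorem shellPullback_eq_const {ν : ℤ} (hν : (M : ℤ) ≤ ν) :
    shellPullback p n φ ν = LocallyConstant.const _ (φ.1 0) := by
  ext x
  refine hM _ ?_
  rw [ContinuousMap.coe_mk, norm_smul, hnorm, mul_one, norm_padic_zpow_le_iff]
  exact hν

include hM' hnorm in
theorem shellPullback_eq_zero {ν : ℤ} (hν : ν < -(M : ℤ)) :
    shellPullback p n φ ν = 0 := by
  ext x
  by_contra h
  have h1 := hM' _ h
  rw [ContinuousMap.coe_mk, norm_smul, hnorm, mul_one, norm_padic_zpow_le_iff] at h1
  omega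

theorem sliceFst_zero (r : padicUnits p) :
    sliceFst (0 : LocallyConstant (padicUnits p × SphereZ p n K) ℂ) r = 0 := rfl

include hM hM' hnorm in
-- On shells inside the ball where `φ = φ 0` the angular integral no longer depends on `ν`. Both the
-- integral and its absolute version therefore end in a geometric series of ratio below one in norm
-- when `Re z > -n`.
theorem radialIntegral_eq [CompactSpace (SphereZ p n K)] (F : SphereDistribution p n K)
    {θ : ℚ_[p] →*₀ ℂ}
    (hθ : ContinuousOn θ {0}ᶜ) (hθp : θ (p : ℚ_[p]) = 1) {z : ℂ} (hz : -(n : ℝ) < z.re) :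
    IntegrableOn (radialIntegrand F θ φ z) (padicPos p) (padicHaar p) ∧
    ∫ r in padicPos p, radialIntegrand F θ φ z r ∂(padicHaar p)
      = (∑ k ∈ Finset.range (2 * M),
          radialWeight p n z ^ ((k : ℤ) - M) * shellIntegral F θ φ ((k : ℤ) - M))
        + radialWeight p n z ^ (M : ℤ) * shellIntegral F θ φ M / (1 - radialWeight p n z) := by
  have hw0 := radialWeight_ne_zero (p := p) n z
  have hw := norm_radialWeight_lt_one (p := p) hz
  have hconst {ν : ℤ} (hν : (M : ℤ) ≤ ν) : shellPullback p n φ ν = shellPullback p n φ M := by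
    rw [shellPullback_eq_const hM hnorm hν, shellPullback_eq_const hM hnorm le_rfl]
  have hint : IntegrableOn (radialIntegrand F θ φ z) (padicPos p) (padicHaar p) := by
    rw [padicPos_eq_iUnion]
    refine integrableOn_iUnion_of_summable_integral_norm
      (fun ν => integrableOn_shell F hθ hθp φ z ν) ?_
    simp_rw [integral_norm_shell F hθp]
    refine (hasSum_shells (M := M) (B := ∫ r : padicUnits p,
        ‖F (sliceFst (shellPullback p n φ M) r) * θ (r : ℚ_[p])‖ ∂(padicUnitsHaar p))
      (norm_ne_zero_iff.2 hw0) (by rwa [norm_norm]) (fun ν hν => ?_) (fun ν hν => ?_)).summable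
    · simp [shellPullback_eq_zero hM' hnorm hν, sliceFst_zero]
    · rw [hconst hν]
  refine ⟨hint, ?_⟩
  rw [padicPos_eq_iUnion] at hint ⊢
  have h1 := hasSum_integral_iUnion measurableSet_shell pairwise_disjoint_shells hint
  simp_rw [integral_shell F hθp] at h1
  refine h1.unique (hasSum_shells hw0 hw (fun ν hν => ?_) (fun ν hν => ?_))
  · simp [shellIntegral, shellPullback_eq_zero hM' hnorm hν, sliceFst_zero]
  · rw [shellIntegral, hconst hν]
    rfl

end RadialIntegral

/-! ### Homogeneous distributions on `K` -/

section Homogeneous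

variable {p : ℕ} [Fact p.Prime] {n : ℕ} {K : Type*} [NormedField K] [NormedAlgebra ℚ_[p] K]

/-- The analytic continuation of the radial integral, computed shell by shell. -/
noncomputable def radialContinuation (F : SphereDistribution p n K) (θ : ℚ_[p] →*₀ ℂ)
    (φ : BSTestFunction K) (M : ℕ) (z : ℂ) : ℂ :=
  (p : ℂ) ^ (1 - (n : ℤ)) * ((p : ℂ) ^ n - 1) *
    ((∑ k ∈ Finset.range (2 * M),
        radialWeight p n z ^ ((k : ℤ) - M) * shellIntegral F θ φ ((k : ℤ) - M))
      + radialWeight p n z ^ (M : ℤ) * shellIntegral F θ φ M / (1 - radialWeight p n z))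

/-- The only possible pole comes from `1 - radialWeight`. If the numerator vanishes the quotient is
identically zero, also where the denominator is zero. -/
theorem analyticAt_radialContinuation (F : SphereDistribution p n K) (θ : ℚ_[p] →*₀ ℂ)
    (φ : BSTestFunction K) (M : ℕ) {z : ℂ}
    (h : shellIntegral F θ φ M ≠ 0 → radialWeight p n z ≠ 1) :
    AnalyticAt ℂ (radialContinuation F θ φ M) z := by
  have hw := analyticAt_radialWeight (p := p) n z
  have hw0 := radialWeight_ne_zero (p := p) n z
  refine analyticAt_const.mul (AnalyticAt.add ?_ ?_)
  · exact Finset.analyticAt_fun_sum _ fun k _ => (hw.zpow hw0).mul analyticAt_const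
  · by_cases h0 : shellIntegral F θ φ M = 0
    · simp only [h0, mul_zero, zero_div]
      exact analyticAt_const
    · exact ((hw.zpow hw0).mul analyticAt_const).div (analyticAt_const.sub hw)
        (sub_ne_zero.2 (h h0).symm)

theorem radial_constant_ne_zero (hn : n ≠ 0) :
    (p : ℂ) ^ (1 - (n : ℤ)) * ((p : ℂ) ^ n - 1) ≠ 0 := by
  refine mul_ne_zero (zpow_ne_zero _ (by exact_mod_cast (Fact.out : p.Prime).ne_zero)) ?_
  rw [sub_ne_zero]
  have := (Nat.one_lt_pow hn (Fact.out : p.Prime).one_lt).ne'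
  exact_mod_cast this

theorem isRadialProduct_of_homogeneous (hn : ¬ p ∣ n) (hK : IsUnramifiedOverPadic p K)
    (b : Module.Basis (Fin n) ℚ_[p] K) {s : ℂ} {θ : ℚ_[p] →*₀ ℂ} (hθ : ContinuousOn θ {0}ᶜ)
    (hθp : θ (p : ℚ_[p]) = 1) (hπ : ¬ IsExceptional n s θ) (f : BSDistribution K)
    (hf : ∀ (φ : BSTestFunction K) (t : ℚ_[p]) (ht : t ≠ 0), t ∈ padicPos p →
      f (dilate K t ht φ) = quasichar s θ t * (‖t‖ : ℂ) ^ n * f φ) :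
    ∃ F : SphereDistribution p n K, IsRadialProduct s θ F f := by
  have : IsUltrametricDist K := IsUltrametricDist.of_normedAlgebra ℚ_[p]
  have : ProperSpace K := properSpace_extension b
  have hn0 : n ≠ 0 := by rintro rfl; exact hn (dvd_zero p)
  have : CompactSpace (SphereZ p n K) := compactSpace_sphereZ hn0 b
  obtain ⟨e, he⟩ := exists_sphere_homeomorph hn hK b
  have hval (x : K) (hx : x ≠ 0) := exists_norm_eq_norm_zpow hK b hx
  have hnorm := norm_smul_sphere (K := K) hn0 b
  set C : ℂ := (p : ℂ) ^ (1 - (n : ℤ)) * ((p : ℂ) ^ n - 1) with hC_def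
  have hC : C ≠ 0 := radial_constant_ne_zero hn0
  have hfunit (t : padicUnits p) (φ : BSTestFunction K) :
      f (dilate K (t : ℚ_[p]) (padicUnits_ne_zero t) φ) = θ (t : ℚ_[p]) * f φ := by
    rw [hf _ _ _ ⟨0, t, t.2, by simp⟩, quasichar, padicUnits_norm]
    simp
  have hfp (ν : ℤ) (φ : BSTestFunction K) :
      f (dilate K ((p : ℚ_[p]) ^ ν) (zpow_ne_zero ν padic_p_ne_zero) φ)
        = radialWeight p n s ^ ν * f φ := by
    rw [hf _ _ _ ⟨ν, 1, by simp, by simp⟩, quasichar_zpow_mul hθp]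
  let χ : LocallyConstant (padicUnits p) ℂ :=
    ⟨fun r => θ (r : ℚ_[p]), isLocallyConstant_character θ hθ⟩
  have hχ (r : padicUnits p) : χ r = θ (r : ℚ_[p]) := rfl
  let L : LocallyConstant (padicUnits p × SphereZ p n K) ℂ →ₗ[ℂ] ℂ := f ∘ₗ extendSphere e
  have hL (t : padicUnits p) (g) : L (g.comap (translateFst _ t)) = (χ t)⁻¹ * L g := by
    change f _ = (χ t)⁻¹ * f _
    rw [extendSphere_translate he, hfunit, padicUnits_coe_inv, map_inv₀, hχ]
  have hθ0 (t : padicUnits p) : θ (t : ℚ_[p]) ≠ 0 :=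
    (map_ne_zero θ).2 (padicUnits_ne_zero t)
  obtain ⟨F, hF⟩ := equivariant_functional_eq_integral χ
    (fun t r => by rw [hχ, hχ, hχ, Submonoid.coe_mul, map_mul]) hθ0 L hL hC
  have hLshell (φ : BSTestFunction K) (ν : ℤ) :
      f (extendSphere e (shellPullback p n φ ν)) = C * shellIntegral F θ φ ν := hF _
  -- Constants on the sphere, and below the indicator of `O`, are fixed by principal units, so a
  -- nontrivial character forces the value zero.
  have hLconst (h : ∃ t : padicUnits p, θ (t : ℚ_[p]) ≠ 1) (c : ℂ) :
      L (LocallyConstant.const _ c) = 0 := by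
    obtain ⟨t, ht⟩ := h
    have h1 : L (LocallyConstant.const _ c) = (θ (t : ℚ_[p]))⁻¹ * L (LocallyConstant.const _ c) :=
      hL t (LocallyConstant.const _ c)
    by_contra h0
    exact ht (inv_eq_one.1 ((right_eq_mul₀ h0).1 h1))
  have hball (h : ∃ t : padicUnits p, θ (t : ℚ_[p]) ≠ 1) : f (unitBallFunction K) = 0 := by
    obtain ⟨t, ht⟩ := h
    have h1 := hfunit t (unitBallFunction K)
    rw [dilate_padicUnits_unitBallFunction] at h1
    by_contra h0
    exact ht ((right_eq_mul₀ h0).1 h1)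
  have hball' : f (unitBallFunction K) * (1 - radialWeight p n s) = L 1 := by
    have h1 := congrArg f (unitBallFunction_eq_add (e := e) hval)
    rw [map_add, hfp, zpow_one] at h1
    change _ = f (extendSphere e 1)
    linear_combination h1
  have hweight {z : ℂ} (hz : ¬ IsExceptional n z θ)
      (h : ¬ ∃ t : padicUnits p, θ (t : ℚ_[p]) ≠ 1) : radialWeight p n z ≠ 1 := fun hw =>
    hz (isExceptional_of_trivial hθp (fun r => by_contra fun hr => h ⟨r, hr⟩) hw)
  refine ⟨F, hπ, fun φ => ?_⟩
  obtain ⟨M, hM, hM'⟩ := exists_shell_bound (p := p) φ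
  -- On shell `M` the function is the constant `φ 0`; this ties the coefficient of the geometric
  -- tail to `L 1`.
  have hconst : L (LocallyConstant.const _ (φ.1 0)) = C * shellIntegral F θ φ M := by
    rw [← hLshell, shellPullback_eq_const hM hnorm le_rfl]
    rfl
  refine ⟨radialContinuation F θ φ M, fun z hz => ?_, fun z hz => ?_, ?_⟩
  · refine analyticAt_radialContinuation F θ φ M fun h0 => hweight hz fun h => ?_
    rw [hLconst h] at hconst
    exact mul_ne_zero hC h0 hconst.symm
  · obtain ⟨h1, h2⟩ := radialIntegral_eq hM hM' hnorm F hθ hθp hz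
    exact ⟨h1, by rw [h2]; rfl⟩
  · conv_lhs => rw [testFunction_eq_sum_shells he hval φ hM hM']
    rw [map_add, map_sum, map_smul, hfp, radialContinuation, ← hC_def, mul_add, Finset.mul_sum]
    congr 1
    · refine Finset.sum_congr rfl fun k _ => ?_
      rw [hfp, hLshell]
      ring
    -- The tails: both vanish for a nontrivial character; otherwise `hball'` is solved for the value
    -- on the indicator of `O`, dividing by `1 - w ≠ 0`.
    · by_cases h : ∃ t : padicUnits p, θ (t : ℚ_[p]) ≠ 1
      · rw [hLconst h] at hconst
        have h0 : shellIntegral F θ φ M = 0 :=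
          (mul_eq_zero.1 hconst.symm).resolve_left hC
        rw [hball h, h0]
        simp
      · have h1 : 1 - radialWeight p n s ≠ 0 := sub_ne_zero.2 (hweight hπ h).symm
        have h2 : LocallyConstant.const (padicUnits p × SphereZ p n K) (φ.1 0)
            = φ.1 0 • (1 : LocallyConstant (padicUnits p × SphereZ p n K) ℂ) := by
          ext x
          simp
        rw [h2, map_smul, ← hball', smul_eq_mul] at hconst
        rw [smul_eq_mul, mul_div_assoc', eq_div_iff h1]
        linear_combination radialWeight p n s ^ (M : ℤ) * hconst

end Homogeneous

theorem theorem2 (p : ℕ) [Fact p.Prime] (hp : p ≠ 2) (n : ℕ) (hn : ¬ p ∣ n)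
    -- the unramified extension of degree `n`, identified with `ℚ_p^n` by a basis
    (K : Type*) [NormedField K] [NormedAlgebra ℚ_[p] K] (hK : IsUnramifiedOverPadic p K)
    (b : Module.Basis (Fin n) ℚ_[p] K)
    -- a non-exceptional quasicharacter `π(z) = |z|_p ^ s * θ(z)`
    (s : ℂ) (θ : ℚ_[p] →*₀ ℂ) (hθ_cont : ContinuousOn θ {0}ᶜ)
    (hθ_norm : ∀ z : ℚ_[p], z ≠ 0 → ‖θ z‖ = 1) (hθ_p : θ (p : ℚ_[p]) = 1)
    (hπ : ¬ IsExceptional n s θ)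
    (f : BSDistribution (Fin n → ℚ_[p]))
    (hf : IsHomogeneousDistribution (quasichar s θ) f) :
    ∃ F : SphereDistribution p n K,
      IsRadialProduct s θ F (BSDistribution.map b.equivFunL.symm.toHomeomorph f) := by
  refine isRadialProduct_of_homogeneous hn hK b hθ_cont hθ_p hπ _ fun φ t ht htp => ?_
  have h1 := hf (BSTestFunction.comp b.equivFunL.symm.toHomeomorph φ) t ht htp
  refine Eq.trans (congrArg f ?_) h1
  refine Subtype.ext (LocallyConstant.ext fun x => ?_)
  -- The identification of `ℚ_p^n` with `K` is linear, so it commutes with dilations.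
  exact congrArg φ.1 (b.equivFunL.symm.map_smul t⁻¹ x).symm
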